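/- Let $d\ge 1$ and let $b_1,\dots,b_d$ be a basis of $\mathbb{R}^d$; "periodic" means periodic with respect to the lattice $\mathbb{Z}b_1+\dots+\mathbb{Z}b_d$, $Q$ is its period cell, and $L^2=L^2(Q;\mathbb{C})$. Let $\Psi_{eq},V_{eq}:\mathbb{R}^d\to\mathbb{R}$ be periodic $C^2$ functions and $E_{eq},\Lambda\in\mathbb{R}$ such that $(\Psi_{eq},V_{eq},E_{eq})$ is an equilibrium of the Schrödinger–Poisson equation, $$E_{eq}\Psi_{eq}=\Big(-\tfrac12\nabla^2+V_{eq}\Big)\Psi_{eq},\qquad \nabla^2V_{eq}=|\Psi_{eq}|^2-\Lambda,\qquad \Lambda=\frac1{|Q|}\int_Q|\Psi_{eq}|^2 .$$ Define the operators in $L^2$, with periodic boundary conditions, $$\hat H=-\tfrac12\nabla^2+V_{eq}-E_{eq},\qquad \hat G=2\Psi_{eq}\nabla^{-2}\Psi_{eq},\qquad \hat\Theta=\hat H+\hat G,$$ where $\nabla^2$ is the weak periodic Laplacian with domain $\{u\in L^2:\nabla^2u\in L^2\}$ and $\nabla^{-2}f$ is the mean-zero periodic solution $v$ of $\nabla^2v=f-\frac1{|Q|}\int_Qf$.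 Theorem. Suppose that $\omega^2\in\mathbb{C}\setminus\mathbb{R}$ is an eigenvalue of the linearized problem $\omega^2\eta=\hat\Theta R$, $R=\hat H\eta$, i.e. $\hat\Theta\hat H\eta=\omega^2\eta$ for some $\eta\ne0$ in $L^2$ (a propagating instability). Then each of the operators $\hat H$ and $\hat\Theta$ has both a positive and a negative eigenvalue. In particular, $\Psi_{eq}$ is not a ground state of $\hat H$ (an eigenfunction with the lowest eigenvalue), and $\Psi_{eq}$ has a null: $\Psi_{eq}(x)=0$ for some $x\in\mathbb{R}^d$. -/

import Mathlib

noncomputable section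

namespace SchrodingerPoisson

open MeasureTheory
open scoped ContDiff Laplacian

/-- The space `ℝᵈ` with its Euclidean structure. -/
abbrev Space (d : ℕ) := EuclideanSpace ℝ (Fin d)

variable {d : ℕ}

/-- Periodicity with respect to the lattice spanned by the basis `b`. -/
def IsPeriodic {α : Type*} (b : Module.Basis (Fin d) ℝ (Space d)) (f : Space d → α) : Prop :=
  ∀ (i : Fin d) (x : Space d), f (x + b i) = f x

/-- The period cell `{∑ tᵢ bᵢ : 0 ≤ tᵢ < 1}`, i.e. the periodic spatial domain. -/
abbrev cell (b : Module.Basis (Fin d) ℝ (Space d)) : Set (Space d) :=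
  ZSpan.fundamentalDomain b

/-- The complex Hilbert space of functions which are square integrable over the period cell. -/
abbrev L2 (b : Module.Basis (Fin d) ℝ (Space d)) :=
  Lp ℂ 2 (volume.restrict (cell b))

/-- `(Ψ, V, E, Λ)` is an equilibrium state of the Schrödinger-Poisson equation on the periodic
domain: `E Ψ = (-∇²/2 + V) Ψ` and `∇² V = |Ψ|² - Λ`, with real wave function `Ψ`, and with `Λ`
the mean mass density. -/
structure IsEquilibrium (b : Module.Basis (Fin d) ℝ (Space d)) (Ψ V : Space d → ℝ)
    (E Λ : ℝ) : Prop where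
  contDiff_wave : ContDiff ℝ 2 Ψ
  contDiff_potential : ContDiff ℝ 2 V
  periodic_wave : IsPeriodic b Ψ
  periodic_potential : IsPeriodic b V
  schrodinger : ∀ x, E * Ψ x = -(1 / 2) * Δ Ψ x + V x * Ψ x
  poisson : ∀ x, Δ V x = |Ψ x| ^ 2 - Λ
  mean_density : Λ = ⨍ x in cell b, |Ψ x| ^ 2

/-- `∇² u = g` in the weak sense on the periodic domain: the Laplacian is moved to smooth
periodic test functions (which encode the periodic boundary conditions on `u`). -/
def HasWeakLaplacian (b : Module.Basis (Fin d) ℝ (Space d)) (u g : Space d → ℂ) : Prop :=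
  ∀ φ : Space d → ℂ, ContDiff ℝ ∞ φ → IsPeriodic b φ →
    (∫ x in cell b, u x * Δ φ x) = ∫ x in cell b, g x * φ x

/-- `v = ∇⁻² f`: the inverse Laplacian on the periodic domain, which inverts `∇²` on functions of
mean zero and annihilates the constants (the zero Fourier mode). -/
def IsInverseLaplacian (b : Module.Basis (Fin d) ℝ (Space d)) (f : Space d → ℂ) (v : L2 b) :
    Prop :=
  (∫ x in cell b, v x) = 0 ∧ HasWeakLaplacian b v (fun x => f x - ⨍ y in cell b, f y)

/-- The graph of `H = -∇²/2 + V - E`, as an operator in `L2 b` with domain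
`{u ∈ L² : ∇² u ∈ L²}`: `opH b V E u w` means that `u` is in the domain and `H u = w`. -/
def opH (b : Module.Basis (Fin d) ℝ (Space d)) (V : Space d → ℝ) (E : ℝ) (u w : L2 b) : Prop :=
  ∃ g : L2 b, HasWeakLaplacian b u g ∧
    ∀ᵐ x ∂(volume.restrict (cell b)), w x = -(1 / 2) * g x + ((V x : ℂ) - (E : ℂ)) * u x

/-- The graph of `G = 2 Ψ ∇⁻² Ψ`, as an operator in `L2 b`. -/
def opG (b : Module.Basis (Fin d) ℝ (Space d)) (Ψ : Space d → ℝ) (u w : L2 b) : Prop :=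
  ∃ v : L2 b, IsInverseLaplacian b (fun x => (Ψ x : ℂ) * u x) v ∧
    ∀ᵐ x ∂(volume.restrict (cell b)), w x = 2 * (Ψ x : ℂ) * v x

/-- The graph of `Θ = H + G`. -/
def opTheta (b : Module.Basis (Fin d) ℝ (Space d)) (Ψ V : Space d → ℝ) (E : ℝ) (u w : L2 b) :
    Prop :=
  ∃ h k : L2 b, opH b V E u h ∧ opG b Ψ u k ∧ w = h + k

/-- The graph of the product `Θ H`: `R = H η` and `w = Θ R`. -/
def opThetaH (b : Module.Basis (Fin d) ℝ (Space d)) (Ψ V : Space d → ℝ) (E : ℝ) (η w : L2 b) :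
    Prop :=
  ∃ R : L2 b, opH b V E η R ∧ opTheta b Ψ V E R w

/-- `f` is an eigenfunction, with eigenvalue `c`, of the operator with graph `T`. -/
def IsEigenfunction {b : Module.Basis (Fin d) ℝ (Space d)} (T : L2 b → L2 b → Prop) (c : ℂ)
    (f : L2 b) : Prop :=
  f ≠ 0 ∧ T f (c • f)

/-- `c` is an eigenvalue of the operator with graph `T`. -/
def IsEigenvalue {b : Module.Basis (Fin d) ℝ (Space d)} (T : L2 b → L2 b → Prop) (c : ℂ) : Prop :=
  ∃ f : L2 b, IsEigenfunction T c f

/-- The function `Ψ` is a ground state of the operator with graph `T`: it is an eigenfunction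
whose eigenvalue is the lowest one. -/
def IsGroundState {b : Module.Basis (Fin d) ℝ (Space d)} (T : L2 b → L2 b → Prop)
    (Ψ : Space d → ℝ) : Prop :=
  ∃ (ψ : L2 b) (e : ℝ), (∀ᵐ x ∂(volume.restrict (cell b)), ψ x = (Ψ x : ℂ)) ∧
    IsEigenfunction T (e : ℂ) ψ ∧ ∀ e' : ℝ, IsEigenvalue T (e' : ℂ) → e ≤ e'

end SchrodingerPoisson

end

/-! Both `H` and `Θ` are self-adjoint. Put `R = Hη` and `ΘR = ω²η`. Symmetry of `H` makes `⟪η, R⟫`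
real, and symmetry of `Θ` gives `conj(ω²) ⟪η, R⟫ = ω² ⟪η, R⟫`. As `ω²` is not real, `⟪η, Hη⟫ = 0`,
hence also `⟪R, ΘR⟫ = 0`, while neither `Hη` nor `ΘR` vanishes
(`exists_inner_eq_zero_of_eigenvalue`).

A semidefinite form vanishes only on the kernel of its operator, so both forms are indefinite. Both
operators are `-∇²/2` plus a bounded symmetric operator, so they have compact resolvent and their
eigenvectors span a dense subspace; an indefinite form then yields eigenvalues of both signs
(`exists_eigenvalue_of_inner_eq_zero`). This is applied in the Fourier basis, where the weak
Laplacian is diagonal (`hasWeakLaplacian_iff`).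

Finally `HΨ = 0`, so a negative eigenvalue of `H` prevents `Ψ` from being a ground state. If `Ψ` had
no zero, then `V - E = ΔΨ / (2Ψ)` and Picone's identity would make `H` nonnegative
(`integral_picone_nonneg`), excluding a negative eigenvalue. -/

noncomputable section

namespace SchrodingerPoisson

open MeasureTheory Filter Topology
open scoped ContDiff Laplacian InnerProductSpace ComplexConjugate

/-! ### Multipliers in a Hilbert basis. -/

section DiagonalOperators

variable {X ι : Type*} [NormedAddCommGroup X] [InnerProductSpace ℂ X]

/-- `g` is obtained from `u` by multiplying the coefficients in the Hilbert basis `e` by `q`. -/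
def IsMultiplied (e : HilbertBasis ι ℂ X) (q : ι → ℝ) (u g : X) : Prop :=
  ∀ k, ⟪e k, g⟫_ℂ = q k * ⟪e k, u⟫_ℂ

theorem eq_of_forall_inner_eq (e : HilbertBasis ι ℂ X) {u v : X}
    (h : ∀ k, ⟪e k, u⟫_ℂ = ⟪e k, v⟫_ℂ) : u = v := by
  apply e.repr.injective
  ext k
  simpa [e.repr_apply_apply] using h k

theorem IsMultiplied.unique {e : HilbertBasis ι ℂ X} {q : ι → ℝ} {u g g' : X}
    (h : IsMultiplied e q u g) (h' : IsMultiplied e q u g') : g = g' :=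
  eq_of_forall_inner_eq e fun k => (h k).trans (h' k).symm

/-- Parseval turns both sides into the same series, because the multipliers are real. No boundedness
of `q` is needed, so this covers unbounded operators on their domain. -/
theorem IsMultiplied.inner_comm {e : HilbertBasis ι ℂ X} {q : ι → ℝ} {u g u' g' : X}
    (h : IsMultiplied e q u g) (h' : IsMultiplied e q u' g') : ⟪g, u'⟫_ℂ = ⟪u, g'⟫_ℂ := by
  rw [← e.tsum_inner_mul_inner, ← e.tsum_inner_mul_inner]
  refine tsum_congr fun k => ?_
  rw [h' k, ← inner_conj_symm, h k, map_mul, Complex.conj_ofReal, inner_conj_symm]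
  ring

theorem hasSum_norm_inner_sq (e : HilbertBasis ι ℂ X) (u : X) :
    HasSum (fun k => ‖⟪e k, u⟫_ℂ‖ ^ 2) (‖u‖ ^ 2) := by
  have h := (e.hasSum_inner_mul_inner u u).mapL Complex.reCLM
  convert h using 1
  · ext k
    rw [Complex.reCLM_apply, ← inner_conj_symm u, Complex.conj_mul']
    norm_cast
  · exact (inner_self_eq_norm_sq (𝕜 := ℂ) u).symm

theorem exists_isMultiplied_of_bounded (e : HilbertBasis ι ℂ X) {κ : ι → ℝ} {C : ℝ}
    (hC : 0 ≤ C) (hκ : ∀ k, |κ k| ≤ C) (u : X) :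
    ∃ g, IsMultiplied e κ u g ∧ ‖g‖ ≤ C * ‖u‖ := by
  have hs : Summable fun k => ‖(κ k : ℂ) * ⟪e k, u⟫_ℂ‖ ^ 2 := by
    refine Summable.of_nonneg_of_le (fun _ => by positivity) (fun k => ?_)
      ((hasSum_norm_inner_sq e u).summable.mul_left (C ^ 2))
    rw [norm_mul, mul_pow]
    gcongr
    simpa using hκ k
  have hm : Memℓp (fun k => (κ k : ℂ) * ⟪e k, u⟫_ℂ) 2 := by
    refine memℓp_gen ?_
    simpa using hs
  have hg : IsMultiplied e κ u (e.repr.symm ⟨_, hm⟩) := fun k => by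
    rw [← e.repr_apply_apply, LinearIsometryEquiv.apply_symm_apply]
  refine ⟨_, hg, ?_⟩
  refine le_of_sq_le_sq ?_ (by positivity)
  rw [mul_pow]
  refine hasSum_le (fun k => ?_) (hasSum_norm_inner_sq e _)
    ((hasSum_norm_inner_sq e u).mul_left (C ^ 2))
  rw [hg k, norm_mul, mul_pow]
  gcongr
  simpa using hκ k

/-- Bounded multipliers define bounded operators. -/
theorem exists_diagonal (e : HilbertBasis ι ℂ X) {κ : ι → ℝ} {C : ℝ}
    (hC : 0 ≤ C) (hκ : ∀ k, |κ k| ≤ C) :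
    ∃ D : X →L[ℂ] X, (∀ u, IsMultiplied e κ u (D u)) ∧ ‖D‖ ≤ C := by
  choose D hD hDn using exists_isMultiplied_of_bounded e hC hκ
  let D' : X →ₗ[ℂ] X :=
    { toFun := D
      map_add' := fun u v => eq_of_forall_inner_eq e fun k => by
        rw [hD, inner_add_right, inner_add_right, hD, hD]; ring
      map_smul' := fun c u => eq_of_forall_inner_eq e fun k => by
        rw [hD, RingHom.id_apply, inner_smul_right, inner_smul_right, hD]; ring }
  exact ⟨D'.mkContinuous C hDn, hD, D'.mkContinuous_norm_le hC _⟩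

/-- The operator is the norm limit of its finite-rank truncations. -/
theorem isCompactOperator_of_tendsto_zero [CompleteSpace X] (e : HilbertBasis ι ℂ X) {κ : ι → ℝ}
    (hκ : Tendsto κ cofinite (𝓝 0)) {D : X →L[ℂ] X} (hD : ∀ u, IsMultiplied e κ u (D u)) :
    IsCompactOperator D := by
  classical
  have hfin : ∀ s : Finset ι, IsCompactOperator
      (∑ k ∈ s, (κ k : ℂ) • (innerSL ℂ (e k)).smulRight (e k) : X →L[ℂ] X) := by
    intro s
    induction s using Finset.induction_on with
    | empty => simpa using! isCompactOperator_zero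
    | insert a s ha ih =>
      rw [Finset.sum_insert ha]
      refine IsCompactOperator.add (f := ⇑((κ a : ℂ) • (innerSL ℂ (e a)).smulRight (e a))) ?_ ih
      have h1 : IsCompactOperator (innerSL ℂ (e a)) :=
        isCompactOperator_of_locallyCompactSpace_dom _
      exact (h1.clm_comp (ContinuousLinearMap.toSpanSingleton ℂ (e a))).smul (κ a : ℂ)
  have hlim : Tendsto (fun s : Finset ι =>
      (∑ k ∈ s, (κ k : ℂ) • (innerSL ℂ (e k)).smulRight (e k) : X →L[ℂ] X)) atTop (𝓝 D) := by
    rw [Metric.tendsto_atTop]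
    intro ε hε
    have hf : {k | ¬ |κ k| < ε / 2}.Finite := by
      have := hκ.eventually (Metric.ball_mem_nhds (0 : ℝ) (half_pos hε))
      simpa [Filter.eventually_cofinite] using this
    refine ⟨hf.toFinset, fun s hs => ?_⟩
    -- The remainder of the truncation is itself diagonal, with multipliers at most `ε / 2` once `s`
    -- contains all indices of large multipliers.
    obtain ⟨R, hR, hRn⟩ := exists_diagonal e (κ := fun k => if k ∈ s then 0 else κ k)
      (half_pos hε).le (fun k => by
        split_ifs with hk
        · simpa using (half_pos hε).le
        · by_contra hlt
          exact hk (hs (by simpa using (not_le.mp hlt).le)))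
    have hsub : D - ∑ k ∈ s, (κ k : ℂ) • (innerSL ℂ (e k)).smulRight (e k) = R := by
      ext u
      refine eq_of_forall_inner_eq e fun k => ?_
      rw [hR u k, sub_apply, inner_sub_right, hD u k]
      simp only [sum_apply, smul_apply,
        ContinuousLinearMap.smulRight_apply, innerSL_apply_apply, inner_sum, inner_smul_right,
        orthonormal_iff_ite.mp e.orthonormal]
      split_ifs with hk
      · simp [hk]
      · simp [hk]
    rw [dist_comm, dist_eq_norm, hsub]
    linarith
  exact isCompactOperator_of_tendsto hlim (Eventually.of_forall hfin)

end DiagonalOperators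

/-! ### Nonnegative forms and compact self-adjoint operators. -/

section Spectral

variable {X : Type*} [NormedAddCommGroup X] [InnerProductSpace ℂ X]

/-- The form at `x + t P x` is a nonnegative quadratic in `t` without constant term, so its
discriminant `(2 ‖P x‖²)²` is at most zero. -/
theorem apply_eq_zero_of_inner_eq_zero {P : X →L[ℂ] X} (hP : P.IsSymmetric)
    (hpos : ∀ x, 0 ≤ (⟪x, P x⟫_ℂ).re) {x : X} (hx : ⟪x, P x⟫_ℂ = 0) : P x = 0 := by
  have key : ∀ t : ℝ, 0 ≤ (⟪P x, P (P x)⟫_ℂ).re * (t * t) + 2 * ‖P x‖ ^ 2 * t + 0 := by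
    intro t
    have h := hpos (x + (t : ℂ) • P x)
    have h1 : ⟪x, P (P x)⟫_ℂ = ⟪P x, P x⟫_ℂ := (hP x (P x)).symm
    have h2 : (⟪P x, P x⟫_ℂ).re = ‖P x‖ ^ 2 := inner_self_eq_norm_sq (𝕜 := ℂ) _
    rw [map_add, map_smul, inner_add_left, inner_add_right, inner_add_right, inner_smul_left,
      inner_smul_left, inner_smul_right, inner_smul_right, hx, h1, Complex.conj_ofReal] at h
    simp only [Complex.add_re, Complex.re_ofReal_mul, h2, Complex.zero_re] at h
    linarith
  have hd := discrim_le_zero key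
  rw [discrim] at hd
  have : ‖P x‖ ^ 2 = 0 := by nlinarith [sq_nonneg (‖P x‖ ^ 2)]
  simpa using this

/-- An operator acting on the eigenvectors of a compact self-adjoint operator by nonnegative
scalars is nonnegative. -/
theorem inner_nonneg_of_eigenvectors [CompleteSpace X] {K P : X →L[ℂ] X} (hK : IsCompactOperator K)
    (hKs : K.IsSymmetric) (p : ℂ → ℝ)
    (hP : ∀ (μ : ℂ) (v : X), v ≠ 0 → K v = μ • v → P v = (p μ : ℂ) • v ∧ 0 ≤ p μ) (x : X) :
    0 ≤ (⟪x, P x⟫_ℂ).re := by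
  classical
  -- By the spectral theorem finite sums of eigenvectors are dense. On such a sum the cross terms
  -- vanish by orthogonality, and nonnegativity is a closed condition.
  have hdense : Dense ((⨆ μ, Module.End.eigenspace (K : Module.End ℂ X) μ : Submodule ℂ X) :
      Set X) := by
    rw [Submodule.dense_iff_topologicalClosure_eq_top, Submodule.topologicalClosure_eq_top_iff]
    exact ContinuousLinearMap.orthogonalComplement_iSup_eigenspaces_eq_bot hK hKs
  refine hdense.induction (P := fun x => 0 ≤ (⟪x, P x⟫_ℂ).re) ?_ ?_ x
  swap
  · exact isClosed_le continuous_const (by fun_prop)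
  · intro y hy
    obtain ⟨f, hf, rfl⟩ := (Submodule.mem_iSup_iff_exists_finsupp _ _).mp hy
    have hfK : ∀ μ, K (f μ) = μ • f μ := fun μ => Module.End.mem_eigenspace_iff.mp (hf μ)
    have horth : ∀ μ ν, μ ≠ ν → ⟪f μ, f ν⟫_ℂ = 0 := fun μ ν h =>
      hKs.orthogonalFamily_eigenspaces h ⟨f μ, hf μ⟩ ⟨f ν, hf ν⟩
    rw [Finsupp.sum, map_sum, inner_sum, Complex.re_sum]
    refine Finset.sum_nonneg fun μ hμ => ?_
    obtain ⟨h1, h2⟩ := hP μ (f μ) (Finsupp.mem_support_iff.mp hμ) (hfK μ)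
    rw [h1, inner_smul_right, sum_inner, Finset.sum_eq_single_of_mem μ hμ
      (fun ν _ h => horth ν μ h), Complex.re_ofReal_mul]
    exact mul_nonneg h2 (inner_self_nonneg (𝕜 := ℂ))

end Spectral

/-! ### Bounded perturbations of a diagonal operator: resolvent and signs of eigenvalues. -/

section PerturbedDiagonal

variable {X ι : Type*} [NormedAddCommGroup X] [InnerProductSpace ℂ X]

/-- The graph of `-A/2 + B`, where `A` has the eigenvalues `-q` in the Hilbert basis `e`. -/
def PerturbedGraph (e : HilbertBasis ι ℂ X) (q : ι → ℝ) (B : X →L[ℂ] X) (u w : X) : Prop :=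
  ∃ g, IsMultiplied e (fun k => -q k) u g ∧ w = (-(1 / 2) : ℂ) • g + B u

variable {e : HilbertBasis ι ℂ X} {q : ι → ℝ} {B : X →L[ℂ] X}

theorem PerturbedGraph.inner_comm (hB : B.IsSymmetric) {u w u' w' : X}
    (h : PerturbedGraph e q B u w) (h' : PerturbedGraph e q B u' w') :
    ⟪w, u'⟫_ℂ = ⟪u, w'⟫_ℂ := by
  obtain ⟨g, hg, rfl⟩ := h
  obtain ⟨g', hg', rfl⟩ := h'
  have hBs : ⟪B u, u'⟫_ℂ = ⟪u, B u'⟫_ℂ := hB u u'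
  rw [inner_add_left, inner_add_right, hBs, inner_smul_left, inner_smul_right, hg.inner_comm hg']
  simp [Complex.conj_ofNat]

theorem PerturbedGraph.smul {u w : X} (h : PerturbedGraph e q B u w) (c : ℂ) :
    PerturbedGraph e q B (c • u) (c • w) := by
  obtain ⟨g, hg, rfl⟩ := h
  refine ⟨c • g, fun k => ?_, ?_⟩
  · rw [inner_smul_right, inner_smul_right, hg k]; ring
  · rw [map_smul, smul_add, smul_comm]

theorem PerturbedGraph.unique {u w w' : X} (h : PerturbedGraph e q B u w)
    (h' : PerturbedGraph e q B u w') : w = w' := by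
  obtain ⟨g, hg, rfl⟩ := h
  obtain ⟨g', hg', rfl⟩ := h'
  rw [hg.unique hg']

theorem PerturbedGraph.zero_left {w : X} (h : PerturbedGraph e q B 0 w) : w = 0 :=
  h.unique ⟨0, fun k => by simp, by simp⟩

/-- A diagonal operator with eigenvalues tending to infinity, perturbed by a bounded self-adjoint
operator, has compact self-adjoint resolvent. -/
theorem exists_compact_resolvent [CompleteSpace X] (hq : ∀ k, 0 ≤ q k)
    (hq' : Tendsto q cofinite atTop) (hB : B.IsSymmetric) :
    ∃ (c : ℝ) (K : X →L[ℂ] X), IsCompactOperator K ∧ K.IsSymmetric ∧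
      (∀ x, PerturbedGraph e q B (K x) (x - (c : ℂ) • K x)) ∧
      ∀ u w, PerturbedGraph e q B u w → K (w + (c : ℂ) • u) = u := by
  -- Since `D = (-A/2 + c)⁻¹` has norm at most `c⁻¹`, any `c > ‖B‖` makes `1 + D B` invertible by a
  -- Neumann series.
  set c : ℝ := ‖B‖ + 1 with hc
  have hc0 : 0 < c := by positivity
  have hpos : ∀ k, 0 < q k / 2 + c := fun k => by linarith [hq k]
  obtain ⟨D, hD, hDn⟩ := exists_diagonal e (κ := fun k => (q k / 2 + c)⁻¹) (C := c⁻¹)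
    (inv_nonneg.mpr hc0.le) (fun k => by
      rw [abs_of_pos (inv_pos.mpr (hpos k))]
      exact inv_anti₀ hc0 (by linarith [hq k]))
  have hDc : IsCompactOperator D := by
    refine isCompactOperator_of_tendsto_zero e ?_ hD
    refine tendsto_inv_atTop_zero.comp ?_
    exact tendsto_atTop_add_const_right _ _ (hq'.atTop_div_const two_pos)
  have hDB : ‖-(D * B)‖ < 1 := by
    rw [norm_neg]
    calc ‖D * B‖ ≤ ‖D‖ * ‖B‖ := norm_mul_le _ _
      _ ≤ c⁻¹ * ‖B‖ := by gcongr
      _ < 1 := by rw [inv_mul_lt_one₀ hc0]; linarith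
  set U := Units.oneSub (-(D * B)) hDB with hU
  have hUv : ∀ x, (U : X →L[ℂ] X) x = x + D (B x) := fun x => by
    simp [hU, Units.oneSub]
  -- From `-A/2 + B + c = (-A/2 + c)(1 + D B)` the inverse is `(1 + D B)⁻¹ D`, compact because `D`
  -- is.
  set K : X →L[ℂ] X := (↑U⁻¹ : X →L[ℂ] X).comp D with hKdef
  have hUK : ∀ x, K x + D (B (K x)) = D x := fun x => by
    rw [← hUv, hKdef, ContinuousLinearMap.comp_apply, ← mul_apply_eq_comp,
      Units.mul_inv, one_apply_eq_self]
  have hgraph : ∀ x, PerturbedGraph e q B (K x) (x - (c : ℂ) • K x) := by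
    intro x
    -- The witness is `A (K x)`, solved from `-A/2 (K x) + B (K x) = x - c K x`.
    refine ⟨(-2 : ℂ) • (x - (c : ℂ) • K x - B (K x)), fun k => ?_, ?_⟩
    · have h1 : K x = D (x - B (K x)) := by rw [map_sub, ← hUK x]; simp
      have h2 := hD (x - B (K x)) k
      rw [← h1] at h2
      have h3 : ((q k / 2 + c : ℝ) : ℂ) ≠ 0 := by exact_mod_cast (hpos k).ne'
      have h4 : ⟪e k, x - B (K x)⟫_ℂ = ((q k / 2 + c : ℝ) : ℂ) * ⟪e k, K x⟫_ℂ := by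
        rw [h2, Complex.ofReal_inv, mul_inv_cancel_left₀ h3]
      rw [inner_sub_right] at h4
      rw [inner_smul_right, inner_sub_right, inner_sub_right, inner_smul_right]
      push_cast at h4 ⊢
      linear_combination (-2 : ℂ) * h4
    · rw [smul_smul]; norm_num
  refine ⟨c, K, hDc.clm_comp _, fun x y => ?_, hgraph, ?_⟩
  · have h := (hgraph x).inner_comm hB (hgraph y)
    rw [inner_sub_left, inner_sub_right, inner_smul_left, inner_smul_right,
      Complex.conj_ofReal] at h
    simpa using h.symm
  · rintro u w ⟨g, hg, rfl⟩
    have h1 : D ((-(1 / 2) : ℂ) • g + B u + (c : ℂ) • u) = u + D (B u) := by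
      rw [add_right_comm, map_add, add_left_inj]
      refine eq_of_forall_inner_eq e fun k => ?_
      have h3 : ((q k / 2 + c : ℝ) : ℂ) ≠ 0 := by exact_mod_cast (hpos k).ne'
      rw [hD, inner_add_right, inner_smul_right, inner_smul_right, hg k, Complex.ofReal_inv,
        inv_mul_eq_iff_eq_mul₀ h3]
      push_cast
      ring
    rw [hKdef, ContinuousLinearMap.comp_apply, h1, ← hUv, ← mul_apply_eq_comp,
      Units.inv_mul, one_apply_eq_self]

/-- If the quadratic form of a self-adjoint operator with compact resolvent vanishes at a vector
outside the kernel, then the operator has eigenvalues of both signs. -/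
theorem exists_eigenvalue_of_inner_eq_zero [CompleteSpace X] (hq : ∀ k, 0 ≤ q k)
    (hq' : Tendsto q cofinite atTop) (hB : B.IsSymmetric) {u w : X}
    (hu : PerturbedGraph e q B u w) (huw : ⟪u, w⟫_ℂ = 0) (hw : w ≠ 0) {s : ℝ} (hs : s ≠ 0) :
    ∃ E : ℝ, 0 < s * E ∧ ∃ v, v ≠ 0 ∧ PerturbedGraph e q B v ((E : ℂ) • v) := by
  obtain ⟨c, K, hKc, hKs, hgraph, hinv⟩ := exists_compact_resolvent (e := e) hq hq' hB
  by_contra! hcon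
  have hKz : ∀ x, K x = 0 → x = 0 := fun x hx => by
    have := hgraph x
    rw [hx, smul_zero, sub_zero] at this
    exact this.zero_left
  -- With `T = -A/2 + B` and `K = (T + c)⁻¹`, this is `-s K T K`, a bounded substitute for `-s T`.
  -- If no eigenvalue of `T` has the sign of `s`, then `P` is nonnegative.
  set P : X →L[ℂ] X := (-s : ℂ) • (K - (c : ℂ) • K.comp K) with hP
  have hPx : ∀ x, P x = (-s : ℂ) • K (x - (c : ℂ) • K x) := fun x => by simp [hP]
  have hPs : P.IsSymmetric := by
    intro x y
    have h1 : ∀ x y, ⟪K x, y⟫_ℂ = ⟪x, K y⟫_ℂ := hKs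
    change ⟪P x, y⟫_ℂ = ⟪x, P y⟫_ℂ
    rw [hPx, hPx, inner_smul_left, inner_smul_right, h1, map_sub, map_smul, inner_sub_left,
      inner_sub_right, inner_smul_left, inner_smul_right, h1]
    simp
  have hpos : ∀ x, 0 ≤ (⟪x, P x⟫_ℂ).re := by
    refine inner_nonneg_of_eigenvectors hKc hKs (fun μ => -s * (μ.re - c * (μ.re * μ.re))) ?_
    intro μ v hv hμv
    have hμ0 : μ ≠ 0 := by
      rintro rfl
      exact hv (hKz v (by rw [hμv, zero_smul]))
    have hμr : ((μ.re : ℝ) : ℂ) = μ := by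
      have h2 : Module.End.HasEigenvalue (K : Module.End ℂ X) μ :=
        Module.End.hasEigenvalue_of_hasEigenvector
          (Module.End.hasEigenvector_iff.mpr ⟨Module.End.mem_eigenspace_iff.mpr hμv, hv⟩)
      exact Complex.conj_eq_iff_re.mp (hKs.conj_eigenvalue_eq_self h2)
    generalize hr : μ.re = r at hμr
    subst hμr
    have hr0 : r ≠ 0 := by exact_mod_cast hμ0
    constructor
    · rw [hPx, hμv, map_sub, map_smul, map_smul, hμv, smul_smul, smul_smul, ← sub_smul, smul_smul]
      push_cast
      ring_nf
    -- An eigenvalue `r` of `K` corresponds to the eigenvalue `r⁻¹ - c` of `T`, and `P` acts there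
    -- by `-s r² (r⁻¹ - c)`.
    · have h3 := (hgraph v).smul ((r : ℂ)⁻¹)
      rw [hμv, smul_smul, inv_mul_cancel₀ hμ0, one_smul, smul_smul, smul_sub, smul_smul,
        ← sub_smul] at h3
      by_contra hneg
      refine hcon (r⁻¹ - c) ?_ v hv ?_
      · have h4 : s * (r⁻¹ - c) = -(-s * (r - c * (r * r))) / (r * r) := by
          field_simp
        rw [h4]
        exact div_pos (by linarith) (mul_self_pos.mpr hr0)
      · convert h3 using 2
        push_cast
        field_simp
  have hx := hinv u w hu
  have hsC : (-s : ℂ) ≠ 0 := by simpa using hs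
  have hPw : P (w + (c : ℂ) • u) = (-s : ℂ) • K w := by
    rw [hPx, hx, add_sub_cancel_right]
  -- As `K (w + c u) = u`, the form of `P` at this vector is `-s ⟪u, w⟫ = 0`; then `K w = 0`,
  -- contradicting `w ≠ 0`.
  have hzero : P (w + (c : ℂ) • u) = 0 := by
    refine apply_eq_zero_of_inner_eq_zero hPs hpos ?_
    have h1 : ⟪K (w + (c : ℂ) • u), w⟫_ℂ = ⟪w + (c : ℂ) • u, K w⟫_ℂ := hKs _ _
    rw [hPw, inner_smul_right, ← h1, hx, huw, mul_zero]
  rw [hPw, smul_eq_zero_iff_right hsC] at hzero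
  exact hw (hKz w hzero)

end PerturbedDiagonal

/-! ### Calculus on the period cell: integration by parts, Green and Picone identities. -/

section PeriodicFunctions

variable {d : ℕ} (b : Module.Basis (Fin d) ℝ (Space d))

instance isFiniteMeasure_restrict_cell : IsFiniteMeasure (volume.restrict (cell b)) :=
  isFiniteMeasure_restrict.mpr (ZSpan.fundamentalDomain_isBounded b).measure_lt_top.ne

variable {b}

theorem IsPeriodic.add_mem_span {α : Type*} {f : Space d → α} (hf : IsPeriodic b f) {v : Space d}
    (hv : v ∈ Submodule.span ℤ (Set.range b)) (x : Space d) : f (x + v) = f x := by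
  induction hv using Submodule.span_induction generalizing x with
  | mem v hv => obtain ⟨i, rfl⟩ := hv; exact hf i x
  | zero => rw [add_zero]
  | add v w _ _ hv hw => rw [← add_assoc, hw, hv]
  | smul n v _ hv =>
    induction n using Int.induction_on generalizing x with
    | zero => simp
    | succ n ih => rw [add_smul, one_smul, ← add_assoc, hv, ih]
    | pred n ih => rw [← hv, sub_smul, one_smul, add_assoc, sub_add_cancel, ih]

theorem IsPeriodic.apply_fract {α : Type*} {f : Space d → α} (hf : IsPeriodic b f) (x : Space d) :
    f (ZSpan.fract b x) = f x := by
  rw [ZSpan.fract_apply, sub_eq_add_neg]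
  exact hf.add_mem_span (neg_mem (ZSpan.floor b x).2) x

theorem IsPeriodic.exists_norm_le {F : Type*} [NormedAddCommGroup F] {f : Space d → F}
    (hf : IsPeriodic b f) (hc : Continuous f) : ∃ C, ∀ x, ‖f x‖ ≤ C := by
  obtain ⟨C, hC⟩ :=
    (ZSpan.fundamentalDomain_isBounded b).isCompact_closure.exists_bound_of_continuousOn
      hc.continuousOn
  refine ⟨C, fun x => ?_⟩
  rw [← hf.apply_fract]
  exact hC _ (subset_closure (ZSpan.fract_mem_fundamentalDomain b x))

theorem integrableOn_cell {F : Type*} [NormedAddCommGroup F] {f : Space d → F}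
    (hc : Continuous f) : IntegrableOn f (cell b) :=
  (hc.continuousOn.integrableOn_compact
    (ZSpan.fundamentalDomain_isBounded b).isCompact_closure).mono_set subset_closure

/-- A translate of the cell is again a fundamental domain of the lattice, and the integral of a
periodic function is the same over all of them. -/
theorem IsPeriodic.integral_translate {F : Type*} [NormedAddCommGroup F] [NormedSpace ℝ F]
    {f : Space d → F} (hf : IsPeriodic b f) (t : Space d) :
    ∫ x in cell b, f (x + t) = ∫ x in cell b, f x := by
  have h1 := ZSpan.isAddFundamentalDomain' b (volume : Measure (Space d))
  have : Countable (Submodule.span ℤ (Set.range b)).toAddSubgroup :=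
    inferInstanceAs (Countable (Submodule.span ℤ (Set.range b)))
  have h2 := h1.vadd_of_comm t
  have h3 := h2.setIntegral_eq h1 (f := f) (fun g x => by
    rw [AddSubgroup.vadd_def, vadd_eq_add, add_comm]; exact hf.add_mem_span g.2 x)
  rw [← h3]
  have h4 := (measurePreserving_vadd t (volume : Measure (Space d))).setIntegral_image_emb
    (measurableEmbedding_const_vadd t) f (cell b)
  simp only [vadd_eq_add] at h4
  simp_rw [add_comm _ t]
  exact h4.symm

theorem IsPeriodic.fderiv {F : Type*} [NormedAddCommGroup F] [NormedSpace ℝ F]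
    {f : Space d → F} (hf : IsPeriodic b f) : IsPeriodic b (fderiv ℝ f) := by
  intro i x
  rw [← fderiv_comp_add_right]
  congr 1
  ext y
  exact hf i y

/-- Differentiate the constant function `t ↦ ∫ f (x + t v)` under the integral sign at `t = 0`. This
replaces the divergence theorem, with no boundary terms. -/
theorem IsPeriodic.integral_fderiv {F : Type*} [NormedAddCommGroup F] [NormedSpace ℝ F]
    {f : Space d → F} (hf : IsPeriodic b f) (hc : ContDiff ℝ 1 f) (v : Space d) :
    ∫ x in cell b, _root_.fderiv ℝ f x v = 0 := by
  have hcont : Continuous (_root_.fderiv ℝ f) := hc.continuous_fderiv one_ne_zero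
  obtain ⟨C, hC⟩ := hf.fderiv.exists_norm_le hcont
  have h := hasDerivAt_integral_of_dominated_loc_of_deriv_le (μ := volume.restrict (cell b))
    (F := fun (t : ℝ) x => f (x + t • v)) (F' := fun t x => _root_.fderiv ℝ f (x + t • v) v)
    (x₀ := 0) (s := Set.univ) (bound := fun _ => C * ‖v‖) univ_mem
    (Eventually.of_forall fun t => (hc.continuous.comp (by fun_prop)).aestronglyMeasurable)
    (integrableOn_cell (hc.continuous.comp (by fun_prop)))
    ((by fun_prop : Continuous fun x => _root_.fderiv ℝ f (x + (0 : ℝ) • v) v).aestronglyMeasurable)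
    (Eventually.of_forall fun x t _ => (_root_.fderiv ℝ f (x + t • v)).le_of_opNorm_le (hC _) v)
    (integrable_const _)
    (Eventually.of_forall fun x t _ => by
      have h1 : HasDerivAt (fun t : ℝ => x + t • v) v t := by
        simpa using ((hasDerivAt_id t).smul_const v).const_add x
      exact ((hc.differentiable one_ne_zero) (x + t • v)).hasFDerivAt.comp_hasDerivAt t h1)
  have h2 := h.2
  simp_rw [hf.integral_translate] at h2
  have h3 := h2.unique (hasDerivAt_const _ _)
  simpa using h3

/-- The directional derivative along the `i`-th coordinate. -/
def partialDeriv {F : Type*} [NormedAddCommGroup F] [NormedSpace ℝ F] (i : Fin d)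
    (f : Space d → F) (x : Space d) : F :=
  fderiv ℝ f x (EuclideanSpace.basisFun (Fin d) ℝ i)

section PartialDeriv

variable {F : Type*} [NormedAddCommGroup F] [NormedSpace ℝ F] {f : Space d → F} {i : Fin d}

theorem IsPeriodic.partialDeriv (hf : IsPeriodic b f) :
    IsPeriodic b (SchrodingerPoisson.partialDeriv i f) := fun j x => by
  rw [SchrodingerPoisson.partialDeriv, hf.fderiv j x, SchrodingerPoisson.partialDeriv]

theorem contDiff_partialDeriv {n : WithTop ℕ∞} (hf : ContDiff ℝ (n + 1) f) :
    ContDiff ℝ n (partialDeriv i f) :=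
  (hf.fderiv_right le_rfl).clm_apply contDiff_const

theorem laplacian_eq_sum_partialDeriv (hf : ContDiff ℝ 2 f) (x : Space d) :
    Δ f x = ∑ i, partialDeriv i (partialDeriv i f) x := by
  rw [congrFun (InnerProductSpace.laplacian_eq_iteratedFDeriv_orthonormalBasis f
    (EuclideanSpace.basisFun (Fin d) ℝ)) x]
  refine Finset.sum_congr rfl fun i _ => ?_
  have h : DifferentiableAt ℝ (fderiv ℝ f) x :=
    (hf.fderiv_right (m := 1) le_rfl).differentiable one_ne_zero x
  have h2 := fderiv_clm_apply h (differentiableAt_const (EuclideanSpace.basisFun (Fin d) ℝ i))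
  rw [iteratedFDeriv_two_apply]
  unfold partialDeriv
  rw [h2]
  simp

theorem continuous_laplacian (hf : ContDiff ℝ 2 f) : Continuous (Δ f) := by
  rw [funext (laplacian_eq_sum_partialDeriv hf)]
  exact continuous_finsetSum _ fun i _ =>
    (contDiff_partialDeriv (n := 0) (contDiff_partialDeriv (n := 1) hf)).continuous

theorem partialDeriv_mul {𝔸 : Type*} [NormedCommRing 𝔸] [NormedAlgebra ℝ 𝔸] {f g : Space d → 𝔸}
    {x : Space d} (hf : DifferentiableAt ℝ f x) (hg : DifferentiableAt ℝ g x) :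
    partialDeriv i (fun y => f y * g y) x = f x * partialDeriv i g x + g x * partialDeriv i f x := by
  simp [partialDeriv, fderiv_fun_mul hf hg]

theorem partialDeriv_sub {f g : Space d → F} {x : Space d} (hf : DifferentiableAt ℝ f x)
    (hg : DifferentiableAt ℝ g x) :
    partialDeriv i (fun y => f y - g y) x = partialDeriv i f x - partialDeriv i g x := by
  simp [partialDeriv, fderiv_fun_sub hf hg]

theorem integral_partialDeriv (hf : IsPeriodic b f) (hc : ContDiff ℝ 1 f) :
    ∫ x in cell b, SchrodingerPoisson.partialDeriv i f x = 0 :=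
  hf.integral_fderiv hc _

end PartialDeriv

/-- Green's identity on the period cell. -/
theorem integral_mul_laplacian {u φ : Space d → ℂ} (hu : ContDiff ℝ 2 u) (hφ : ContDiff ℝ 2 φ)
    (hup : IsPeriodic b u) (hφp : IsPeriodic b φ) :
    ∫ x in cell b, u x * Δ φ x = ∫ x in cell b, Δ u x * φ x := by
  have hd : ∀ {f : Space d → ℂ}, ContDiff ℝ 2 f → ∀ i, ContDiff ℝ 1 (partialDeriv i f) :=
    fun hf i => contDiff_partialDeriv (n := 1) hf
  have h1 : ∀ {f : Space d → ℂ}, ContDiff ℝ 2 f → ContDiff ℝ 1 f := fun hf => hf.of_le one_le_two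
  -- The difference is the divergence of the periodic field `u ∇φ - φ ∇u`, so it integrates to zero.
  have key : ∀ x, u x * Δ φ x - Δ u x * φ x = ∑ i, partialDeriv i
      (fun y => u y * partialDeriv i φ y - φ y * partialDeriv i u y) x := by
    intro x
    rw [laplacian_eq_sum_partialDeriv hu, laplacian_eq_sum_partialDeriv hφ, Finset.mul_sum,
      Finset.sum_mul, ← Finset.sum_sub_distrib]
    refine Finset.sum_congr rfl fun i _ => ?_
    have hdu := (h1 hu).differentiable one_ne_zero x
    have hdφ := (h1 hφ).differentiable one_ne_zero x
    have hdu' := (hd hu i).differentiable one_ne_zero x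
    have hdφ' := (hd hφ i).differentiable one_ne_zero x
    have e1 := partialDeriv_mul (i := i) hdu hdφ'
    have e2 := partialDeriv_mul (i := i) hdφ hdu'
    have e3 : partialDeriv i (fun y => u y * partialDeriv i φ y - φ y * partialDeriv i u y) x =
        partialDeriv i (fun y => u y * partialDeriv i φ y) x -
        partialDeriv i (fun y => φ y * partialDeriv i u y) x := by
      exact partialDeriv_sub (hdu.fun_mul hdφ') (hdφ.fun_mul hdu')
    rw [e3, e1, e2]
    ring
  have hW : ∀ i, ContDiff ℝ 1 (fun y => u y * partialDeriv i φ y - φ y * partialDeriv i u y) :=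
    fun i => ((h1 hu).mul (hd hφ i)).sub ((h1 hφ).mul (hd hu i))
  have hi1 : IntegrableOn (fun x => u x * Δ φ x) (cell b) :=
    integrableOn_cell (hu.continuous.mul (continuous_laplacian hφ))
  have hi2 : IntegrableOn (fun x => Δ u x * φ x) (cell b) :=
    integrableOn_cell ((continuous_laplacian hu).mul hφ.continuous)
  rw [← sub_eq_zero, ← integral_sub hi1 hi2, funext key,
    integral_finsetSum _ fun i _ => integrableOn_cell
      (contDiff_partialDeriv (n := 0) (hW i)).continuous]
  refine Finset.sum_eq_zero fun i _ => integral_partialDeriv (fun j x => ?_) (hW i)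
  rw [hup j, hφp j, hup.partialDeriv j, hφp.partialDeriv j]

theorem partialDeriv_clm_comp {F G : Type*} [NormedAddCommGroup F] [NormedSpace ℝ F]
    [NormedAddCommGroup G] [NormedSpace ℝ G] (l : F →L[ℝ] G) {f : Space d → F} {x : Space d}
    (hf : DifferentiableAt ℝ f x) (i : Fin d) :
    partialDeriv i (fun y => l (f y)) x = l (partialDeriv i f x) := by
  have := (l.hasFDerivAt.comp x hf.hasFDerivAt).fderiv
  simp only [partialDeriv]
  change fderiv ℝ (l ∘ f) x _ = _
  rw [this]
  rfl

/-- The Jacobi-Picone inequality: `-Δ + ΔΨ / Ψ` is nonnegative if `Ψ` has no zeros. -/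
theorem integral_picone_nonneg {Ψ : Space d → ℝ} {φ : Space d → ℂ} (hΨ : ContDiff ℝ 2 Ψ)
    (hφ : ContDiff ℝ 2 φ) (hΨp : IsPeriodic b Ψ) (hφp : IsPeriodic b φ) (h0 : ∀ x, Ψ x ≠ 0) :
    0 ≤ (∫ x in cell b, starRingEnd ℂ (φ x) *
      (-Δ φ x + ((Δ Ψ x / Ψ x : ℝ) : ℂ) * φ x)).re := by
  have hd : ∀ i, ContDiff ℝ 1 (partialDeriv i φ) := fun i => contDiff_partialDeriv (n := 1) hφ
  have hdΨ : ∀ i, ContDiff ℝ 1 (partialDeriv i Ψ) := fun i => contDiff_partialDeriv (n := 1) hΨ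
  have hφ1 : ContDiff ℝ 1 φ := hφ.of_le one_le_two
  have hΨ1 : ContDiff ℝ 1 Ψ := hΨ.of_le one_le_two
  have hφs : ContDiff ℝ 1 (fun x => starRingEnd ℂ (φ x)) :=
    (Complex.conjCLE.contDiff.of_le le_top).comp hφ1
  have hq : ∀ i, ContDiff ℝ 1 (fun x => ((partialDeriv i Ψ x / Ψ x : ℝ) : ℂ)) := fun i =>
    (Complex.ofRealCLM.contDiff.of_le le_top).comp ((hdΨ i).div hΨ1 h0)
  set W : Fin d → Space d → ℂ := fun i x => starRingEnd ℂ (φ x) *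
    (partialDeriv i φ x - ((partialDeriv i Ψ x / Ψ x : ℝ) : ℂ) * φ x) with hWdef
  have hW : ∀ i, ContDiff ℝ 1 (W i) := fun i => hφs.mul ((hd i).sub ((hq i).mul hφ1))
  have hWp : ∀ i, IsPeriodic b (W i) := fun i j x => by
    simp only [hWdef]
    rw [hφp j, hφp.partialDeriv j, hΨp j, hΨp.partialDeriv j]
  set N : Fin d → Space d → ℝ := fun i x =>
    ‖partialDeriv i φ x - ((partialDeriv i Ψ x / Ψ x : ℝ) : ℂ) * φ x‖ ^ 2 with hN
  -- Picone's identity: the integrand is `|∇φ - (∇Ψ/Ψ) φ|²` minus the divergence of the periodic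
  -- field `W = conj φ (∇φ - (∇Ψ/Ψ) φ)`.
  have key : ∀ x, starRingEnd ℂ (φ x) * (-Δ φ x + ((Δ Ψ x / Ψ x : ℝ) : ℂ) * φ x) =
      ((∑ i, N i x : ℝ) : ℂ) - ∑ i, partialDeriv i (W i) x := by
    intro x
    rw [laplacian_eq_sum_partialDeriv hφ, laplacian_eq_sum_partialDeriv hΨ, Finset.sum_div,
      Complex.ofReal_sum, Complex.ofReal_sum, ← Finset.sum_neg_distrib, Finset.sum_mul,
      ← Finset.sum_add_distrib, Finset.mul_sum, ← Finset.sum_sub_distrib]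
    refine Finset.sum_congr rfl fun i _ => ?_
    have dφ := hφ1.differentiable one_ne_zero x
    have dΨ := hΨ1.differentiable one_ne_zero x
    have dφs := hφs.differentiable one_ne_zero x
    have dq := (hq i).differentiable one_ne_zero x
    have dr : DifferentiableAt ℝ (fun y => partialDeriv i Ψ y / Ψ y) x :=
      ((hdΨ i).div hΨ1 h0).differentiable one_ne_zero x
    have ddφ := (hd i).differentiable one_ne_zero x
    have ddΨ := (hdΨ i).differentiable one_ne_zero x
    have e1 : partialDeriv i (fun y => starRingEnd ℂ (φ y)) x =
        starRingEnd ℂ (partialDeriv i φ x) :=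
      partialDeriv_clm_comp (Complex.conjCLE : ℂ →L[ℝ] ℂ) dφ i
    have e2 : partialDeriv i (fun y => ((partialDeriv i Ψ y / Ψ y : ℝ) : ℂ)) x =
        ((partialDeriv i (partialDeriv i Ψ) x / Ψ x -
          partialDeriv i Ψ x ^ 2 / Ψ x ^ 2 : ℝ) : ℂ) := by
      rw [show (fun y => ((partialDeriv i Ψ y / Ψ y : ℝ) : ℂ)) =
        fun y => Complex.ofRealCLM (partialDeriv i Ψ y / Ψ y) from rfl,
        partialDeriv_clm_comp Complex.ofRealCLM dr i, Complex.ofRealCLM_apply]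
      congr 1
      -- The quotient rule, read off from the product rule for `(∂ᵢΨ / Ψ) Ψ = ∂ᵢΨ`.
      have h := partialDeriv_mul (i := i) dr dΨ
      simp_rw [div_mul_cancel₀ _ (h0 _)] at h
      have hx := h0 x
      rw [h]
      field_simp
      ring
    have e3 : partialDeriv i (W i) x = starRingEnd ℂ (φ x) *
        (partialDeriv i (partialDeriv i φ) x - (((partialDeriv i Ψ x / Ψ x : ℝ) : ℂ) *
          partialDeriv i φ x + φ x * ((partialDeriv i (partialDeriv i Ψ) x / Ψ x -
          partialDeriv i Ψ x ^ 2 / Ψ x ^ 2 : ℝ) : ℂ))) +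
        (partialDeriv i φ x - ((partialDeriv i Ψ x / Ψ x : ℝ) : ℂ) * φ x) *
          starRingEnd ℂ (partialDeriv i φ x) := by
      rw [hWdef, partialDeriv_mul dφs (ddφ.fun_sub (dq.fun_mul dφ)), e1]
      congr 2
      rw [partialDeriv, fderiv_fun_sub ddφ (dq.fun_mul dφ), sub_apply]
      congr 1
      rw [← e2]
      exact partialDeriv_mul dq dφ
    rw [e3, hN]
    simp only
    rw [Complex.ofReal_pow, ← Complex.mul_conj']
    simp only [map_sub, map_mul, Complex.conj_ofReal]
    have := h0 x
    push_cast
    ring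
  have hNc : ∀ i, Continuous (N i) := fun i =>
    (((hd i).sub ((hq i).mul hφ1)).continuous.norm.pow 2)
  have hWc : ∀ i, Continuous (partialDeriv i (W i)) := fun i =>
    (contDiff_partialDeriv (n := 0) (hW i)).continuous
  have hNs : Continuous fun x => ∑ i, N i x := continuous_finsetSum _ fun i _ => hNc i
  have hNi : IntegrableOn (fun x => ((∑ i, N i x : ℝ) : ℂ)) (cell b) :=
    integrableOn_cell (Complex.continuous_ofReal.comp hNs)
  rw [funext key, integral_sub hNi
    (integrableOn_cell (continuous_finsetSum _ fun i _ => hWc i)),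
    integral_finsetSum _ (fun i _ => integrableOn_cell (hWc i)),
    Finset.sum_eq_zero (fun i _ => integral_partialDeriv (hWp i) (hW i)), sub_zero,
    integral_complex_ofReal, Complex.ofReal_re]
  exact integral_nonneg fun x => Finset.sum_nonneg fun i _ => by positivity

end PeriodicFunctions

/-! ### Plane waves and the growth of their wave numbers. -/

section Exponentials

variable {d : ℕ} (b : Module.Basis (Fin d) ℝ (Space d))

/-- The linear form `2π ∑ kⱼ xⱼ`, with `xⱼ` the coordinates in the basis `b`. -/
def phase (k : Fin d → ℤ) : Space d →L[ℝ] ℝ :=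
  LinearMap.toContinuousLinearMap (∑ j, (2 * Real.pi * k j) • b.coord j)

theorem phase_apply (k : Fin d → ℤ) (x : Space d) :
    phase b k x = ∑ j, 2 * Real.pi * k j * b.repr x j := by
  simp [phase]

theorem phase_basis (k : Fin d → ℤ) (j : Fin d) : phase b k (b j) = 2 * Real.pi * k j := by
  rw [phase_apply, Finset.sum_eq_single j] <;> simp +contextual [eq_comm]

theorem phase_sub (k l : Fin d → ℤ) : phase b (k - l) = phase b k - phase b l := by
  ext x
  simp only [phase_apply, sub_apply, ← Finset.sum_sub_distrib, Pi.sub_apply]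
  exact Finset.sum_congr rfl fun j _ => by push_cast; ring

/-- The plane wave with wave vector in the dual lattice. -/
def planeWave (k : Fin d → ℤ) (x : Space d) : ℂ := Complex.exp (phase b k x * Complex.I)

theorem contDiff_planeWave (k : Fin d → ℤ) {n : WithTop ℕ∞} : ContDiff ℝ n (planeWave b k) :=
  ((Complex.ofRealCLM.contDiff.comp (phase b k).contDiff).mul contDiff_const).cexp

theorem conj_planeWave_mul (k l : Fin d → ℤ) (x : Space d) :
    conj (planeWave b k x) * planeWave b l x = planeWave b (l - k) x := by
  rw [planeWave, planeWave, planeWave, ← Complex.exp_conj, ← Complex.exp_add, phase_sub]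
  congr 1
  simp
  ring

theorem planeWave_zero (x : Space d) : planeWave b 0 x = 1 := by
  simp [planeWave, phase_apply]

theorem conj_planeWave (k : Fin d → ℤ) (x : Space d) :
    conj (planeWave b k x) = planeWave b (-k) x := by
  simpa [planeWave_zero] using conj_planeWave_mul b k 0 x

theorem isPeriodic_planeWave (k : Fin d → ℤ) : IsPeriodic b (planeWave b k) := by
  intro j x
  rw [planeWave, planeWave, map_add, phase_basis]
  refine Complex.exp_eq_exp_iff_exists_int.mpr ⟨k j, ?_⟩
  push_cast
  ring

theorem partialDeriv_planeWave (k : Fin d → ℤ) (i : Fin d) (x : Space d) :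
    partialDeriv i (planeWave b k) x =
      (phase b k (EuclideanSpace.basisFun (Fin d) ℝ i) * Complex.I) * planeWave b k x := by
  have h1 : HasFDerivAt (fun x => (phase b k x : ℂ) * Complex.I)
      ((Complex.ofRealCLM.comp (phase b k)).smulRight Complex.I) x :=
    ((Complex.ofRealCLM.comp (phase b k)).smulRight Complex.I).hasFDerivAt
  have h2 := h1.cexp
  rw [partialDeriv, show planeWave b k = fun x => Complex.exp (phase b k x * Complex.I) from rfl,
    h2.fderiv]
  simp
  ring

/-- The squared length of the wave vector. -/
def waveNumberSq (k : Fin d → ℤ) : ℝ :=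
  ∑ i, phase b k (EuclideanSpace.basisFun (Fin d) ℝ i) ^ 2

theorem laplacian_planeWave (k : Fin d → ℤ) (x : Space d) :
    Δ (planeWave b k) x = -(waveNumberSq b k : ℂ) * planeWave b k x := by
  rw [laplacian_eq_sum_partialDeriv (contDiff_planeWave b k), waveNumberSq, Complex.ofReal_sum,
    ← Finset.sum_neg_distrib, Finset.sum_mul]
  refine Finset.sum_congr rfl fun i _ => ?_
  rw [funext (partialDeriv_planeWave b k i), partialDeriv_mul (differentiableAt_const _)
    ((contDiff_planeWave b k (n := 1)).differentiable one_ne_zero x), partialDeriv_planeWave]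
  have : partialDeriv i (fun _ : Space d =>
      (phase b k (EuclideanSpace.basisFun (Fin d) ℝ i) : ℂ) * Complex.I) x = 0 := by
    simp [partialDeriv]
  rw [this]
  push_cast
  linear_combination ((phase b k (EuclideanSpace.basisFun (Fin d) ℝ i) : ℂ)) ^ 2 *
    planeWave b k x * Complex.I_sq

theorem waveNumberSq_nonneg (k : Fin d → ℤ) : 0 ≤ waveNumberSq b k :=
  Finset.sum_nonneg fun _ _ => sq_nonneg _

theorem phase_apply_sq_le (k : Fin d → ℤ) (x : Space d) :
    phase b k x ^ 2 ≤ waveNumberSq b k * ‖x‖ ^ 2 := by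
  have h1 : phase b k x = ∑ i, phase b k (EuclideanSpace.basisFun (Fin d) ℝ i) * x i := by
    conv_lhs => rw [← (EuclideanSpace.basisFun (Fin d) ℝ).sum_repr x, map_sum]
    refine Finset.sum_congr rfl fun i _ => ?_
    rw [map_smul, smul_eq_mul, mul_comm, EuclideanSpace.basisFun_repr]
  rw [h1, EuclideanSpace.real_norm_sq_eq]
  exact Finset.sum_mul_sq_le_sq_mul_sq _ _ _

/-- Cauchy–Schwarz for the phase evaluated at `b j`, where it equals `2π k j`. It yields both
positivity of the wave number for `k ≠ 0` and its divergence at infinity. -/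
theorem coeff_sq_le (k : Fin d → ℤ) (j : Fin d) :
    (k j : ℝ) ^ 2 ≤ waveNumberSq b k * ‖b j‖ ^ 2 := by
  have h := phase_apply_sq_le b k (b j)
  rw [phase_basis] at h
  refine le_trans ?_ h
  have : (1 : ℝ) ≤ (2 * Real.pi) ^ 2 := one_le_pow₀ (by linarith [Real.pi_gt_three])
  nlinarith [sq_nonneg (k j : ℝ)]

theorem waveNumberSq_pos {k : Fin d → ℤ} (hk : k ≠ 0) : 0 < waveNumberSq b k := by
  obtain ⟨j, hj⟩ := Function.ne_iff.mp hk
  refine lt_of_le_of_ne (waveNumberSq_nonneg b k) fun h => ?_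
  have h1 := coeff_sq_le b k j
  rw [← h, zero_mul] at h1
  have h2 : (k j : ℝ) ≠ 0 := by exact_mod_cast hj
  exact absurd h1 (not_le.mpr (by positivity))

theorem waveNumberSq_zero : waveNumberSq b 0 = 0 := by
  simp [waveNumberSq, phase_apply]

theorem tendsto_waveNumberSq : Tendsto (waveNumberSq b) cofinite atTop := by
  rw [tendsto_atTop]
  intro C
  rw [eventually_cofinite]
  set M : Fin d → ℤ := fun j => ⌈|C| * ‖b j‖ ^ 2⌉ with hM
  refine (Set.finite_Icc (-M) M).subset fun k hk => ?_
  have hk' : waveNumberSq b k ≤ |C| := (not_le.mp hk).le.trans (le_abs_self C)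
  have h : ∀ j, |k j| ≤ M j := fun j => by
    have h1 : (k j : ℝ) ^ 2 ≤ M j :=
      (coeff_sq_le b k j).trans (le_trans (by gcongr) (Int.le_ceil _))
    have h2 : (k j) ^ 2 ≤ M j := by exact_mod_cast h1
    refine le_trans ?_ h2
    rw [← sq_abs]
    exact Int.le_self_sq _
  exact ⟨fun j => (abs_le.mp (h j)).1, fun j => (abs_le.mp (h j)).2⟩

/-- Green's identity against the constant `1` gives `waveNumberSq b k * ∫ planeWave b k = 0`. -/
theorem integral_planeWave {k : Fin d → ℤ} (hk : k ≠ 0) : ∫ x in cell b, planeWave b k x = 0 := by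
  have h := integral_mul_laplacian (b := b) (u := fun _ => 1) contDiff_const
    (contDiff_planeWave b k) (fun _ _ => rfl) (isPeriodic_planeWave b k)
  simp only [laplacian_planeWave, one_mul, integral_const_mul] at h
  have h2 : (waveNumberSq b k : ℂ) ≠ 0 := by exact_mod_cast (waveNumberSq_pos b hk).ne'
  have h0 : Δ (fun _ : Space d => (1 : ℂ)) = 0 := InnerProductSpace.laplacian_const
  simpa [h0, h2] using h

end Exponentials

/-! ### Normalized plane waves in `L2 b` and the map to the torus. -/

section FourierBasis

variable {d : ℕ} (b : Module.Basis (Fin d) ℝ (Space d))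

theorem memLp_cell {f : Space d → ℂ} (hf : Continuous f) (p : ENNReal) :
    MemLp f p (volume.restrict (cell b)) := by
  obtain ⟨C, hC⟩ :=
    (ZSpan.fundamentalDomain_isBounded b).isCompact_closure.exists_bound_of_continuousOn
      hf.continuousOn
  refine MemLp.of_bound hf.aestronglyMeasurable C ?_
  filter_upwards [ae_restrict_mem (ZSpan.fundamentalDomain_measurableSet b)] with x hx
  exact hC x (subset_closure hx)

/-- The class in `L2 b` of a continuous function. -/
def toL2 {f : Space d → ℂ} (hf : Continuous f) : L2 b := (memLp_cell b hf 2).toLp f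

theorem coeFn_toL2 {f : Space d → ℂ} (hf : Continuous f) :
    toL2 b hf =ᵐ[volume.restrict (cell b)] f := MemLp.coeFn_toLp _

theorem inner_toL2 {f : Space d → ℂ} (hf : Continuous f) (u : L2 b) :
    ⟪toL2 b hf, u⟫_ℂ = ∫ x in cell b, conj (f x) * u x := by
  rw [L2.inner_def]
  refine integral_congr_ae ?_
  filter_upwards [coeFn_toL2 b hf] with x hx
  rw [hx, RCLike.inner_apply, mul_comm]

/-- The normalization constant of the plane waves. -/
def waveNorm : ℝ := (Real.sqrt (volume.real (cell b)))⁻¹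

theorem volume_cell_pos : 0 < volume.real (cell b) :=
  ENNReal.toReal_pos (ZSpan.measure_fundamentalDomain_ne_zero b)
    (ZSpan.fundamentalDomain_isBounded b).measure_lt_top.ne

theorem waveNorm_pos : 0 < waveNorm b :=
  inv_pos.mpr (Real.sqrt_pos.mpr (volume_cell_pos b))

/-- The normalized plane wave in `L2 b`. -/
def planeWaveL2 (k : Fin d → ℤ) : L2 b :=
  (waveNorm b : ℂ) • toL2 b (contDiff_planeWave b k (n := 0)).continuous

theorem inner_planeWaveL2 (k : Fin d → ℤ) (u : L2 b) :
    ⟪planeWaveL2 b k, u⟫_ℂ = waveNorm b * ∫ x in cell b, conj (planeWave b k x) * u x := by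
  rw [planeWaveL2, inner_smul_left, inner_toL2, Complex.conj_ofReal]

theorem inner_planeWaveL2_toL2 (k : Fin d → ℤ) {f : Space d → ℂ} (hf : Continuous f) :
    ⟪planeWaveL2 b k, toL2 b hf⟫_ℂ =
      waveNorm b * ∫ x in cell b, conj (planeWave b k x) * f x := by
  rw [inner_planeWaveL2]
  congr 1
  refine integral_congr_ae ?_
  filter_upwards [coeFn_toL2 b hf] with x hx
  rw [hx]

theorem orthonormal_planeWaveL2 : Orthonormal ℂ (planeWaveL2 b) := by
  rw [orthonormal_iff_ite]
  intro k l
  rw [show planeWaveL2 b l = (waveNorm b : ℂ) • toL2 b (contDiff_planeWave b l (n := 0)).continuous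
    from rfl, inner_smul_right, inner_planeWaveL2_toL2]
  simp_rw [conj_planeWave_mul]
  split_ifs with h
  · subst h
    have hv := volume_cell_pos b
    simp only [sub_self, planeWave_zero, integral_const, measureReal_restrict_apply_univ]
    have : waveNorm b * (waveNorm b * volume.real (cell b)) = 1 := by
      have hs := Real.sq_sqrt hv.le
      have hs0 := (Real.sqrt_pos.mpr hv).ne'
      rw [waveNorm]
      field_simp
      exact hs.symm
    rw [Complex.real_smul, mul_one]
    exact_mod_cast this
  · rw [integral_planeWave b (sub_ne_zero.mpr (Ne.symm h)), mul_zero, mul_zero]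

/-- The projection onto the torus. -/
def toTorus (x : Space d) : UnitAddTorus (Fin d) := fun i => (b.repr x i : UnitAddCircle)

theorem continuous_toTorus : Continuous (toTorus b) := by
  refine continuous_pi fun i => ?_
  have h : Continuous fun x => b.repr x i :=
    (LinearMap.continuous_of_finiteDimensional (b.coord i))
  exact (AddCircle.continuous_mk' 1).comp h

theorem injOn_toTorus : Set.InjOn (toTorus b) (cell b) := by
  intro x hx y hy hxy
  apply b.repr.injective
  ext i
  have h := congrFun hxy i
  have hx' := ZSpan.mem_fundamentalDomain b |>.mp hx i
  have hy' := ZSpan.mem_fundamentalDomain b |>.mp hy i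
  exact (AddCircle.coe_eq_coe_iff_of_mem_Ico (p := (1 : ℝ)) (a := 0) (by simpa using hx')
    (by simpa using hy')).mp h

theorem mFourier_toTorus (k : Fin d → ℤ) (x : Space d) :
    UnitAddTorus.mFourier k (toTorus b x) = planeWave b k x := by
  rw [planeWave, phase_apply, UnitAddTorus.mFourier]
  simp only [ContinuousMap.coe_mk, toTorus, fourier_coe_apply]
  rw [← Complex.exp_sum]
  congr 1
  push_cast
  rw [Finset.sum_mul]
  exact Finset.sum_congr rfl fun i _ => by simp; ring

end FourierBasis

/-! ### Completeness of the plane waves; the weak Laplacian in Fourier coefficients. -/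

section FourierCompleteness

variable {d : ℕ} (b : Module.Basis (Fin d) ℝ (Space d))

/-- Trigonometric polynomials are uniformly dense in the continuous functions, which are dense in
`L²` of any finite measure. Allowing arbitrary `ν` avoids identifying the image of Lebesgue measure
with Haar measure. -/
theorem dense_span_mFourier (ν : Measure (UnitAddTorus (Fin d))) [IsFiniteMeasure ν] :
    (Submodule.span ℂ (Set.range fun k : Fin d → ℤ =>
      (ContinuousMap.toLp 2 ν ℂ (UnitAddTorus.mFourier k) : Lp ℂ 2 ν))).topologicalClosure = ⊤ := by
  have h := (ContinuousMap.toLp_denseRange ℂ ν ℂ (p := 2) (by simp)).topologicalClosure_map_submodule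
    (UnitAddTorus.span_mFourier_closure_eq_top (d := Fin d))
  rw [Submodule.map_span, ← Set.range_comp] at h
  exact h

/-- The cell embeds measurably in the torus, so `f` agrees almost everywhere on the cell with `g ∘
toTorus b` for some measurable `g`. Orthogonality to the plane waves becomes orthogonality of `g` to
all torus monomials for the image measure. -/
theorem eq_zero_of_forall_inner_planeWaveL2 {f : L2 b}
    (hf : ∀ k, ⟪planeWaveL2 b k, f⟫_ℂ = 0) : f = 0 := by
  have hmeas : MeasurableSet (cell b) := ZSpan.fundamentalDomain_measurableSet b
  have : StandardBorelSpace (cell b) := hmeas.standardBorel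
  have hT : Measurable (toTorus b) := (continuous_toTorus b).measurable
  have hemb : MeasurableEmbedding fun x : cell b => toTorus b x :=
    (hT.comp measurable_subtype_coe).measurableEmbedding
      (Set.injOn_iff_injective.mp (injOn_toTorus b))
  obtain ⟨g, hg, hgf⟩ := hemb.exists_stronglyMeasurable_extend
    (f := fun x : cell b => f x)
    ((Lp.stronglyMeasurable f).comp_measurable measurable_subtype_coe) (fun _ => inferInstance)
  have hgT : g ∘ toTorus b =ᵐ[volume.restrict (cell b)] f := by
    filter_upwards [ae_restrict_mem hmeas] with x hx
    exact congrFun hgf ⟨x, hx⟩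
  set ν := (volume.restrict (cell b)).map (toTorus b) with hν
  have hgm : MemLp g 2 ν := by
    rw [hν, memLp_map_measure_iff hg.aestronglyMeasurable hT.aemeasurable, memLp_congr_ae hgT]
    exact Lp.memLp f
  have hzero : hgm.toLp g = 0 := by
    have hmem : hgm.toLp g ∈ (Submodule.span ℂ (Set.range fun k : Fin d → ℤ =>
        (ContinuousMap.toLp 2 ν ℂ (UnitAddTorus.mFourier k) : Lp ℂ 2 ν)))ᗮ := by
      rw [Submodule.mem_orthogonal]
      intro w hw
      induction hw using Submodule.span_induction with
      | zero => simp
      | add x y _ _ hx hy => rw [inner_add_left, hx, hy, add_zero]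
      | smul c x _ hx => rw [inner_smul_left, hx, mul_zero]
      | mem w hw =>
        obtain ⟨k, rfl⟩ := hw
        have hk := hf k
        rw [inner_planeWaveL2, mul_eq_zero, or_iff_right
          (by exact_mod_cast (waveNorm_pos b).ne')] at hk
        rw [L2.inner_def, ← hk]
        have h1 : ∀ᵐ y ∂ν, ⟪(ContinuousMap.toLp 2 ν ℂ (UnitAddTorus.mFourier k) : Lp ℂ 2 ν) y,
            hgm.toLp g y⟫_ℂ = conj (UnitAddTorus.mFourier k y) * g y := by
          filter_upwards [ContinuousMap.coeFn_toLp (p := 2) (𝕜 := ℂ) ν (UnitAddTorus.mFourier k),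
            hgm.coeFn_toLp] with y hy1 hy2
          rw [hy1, hy2, RCLike.inner_apply, mul_comm]
        have h2 : StronglyMeasurable fun y => conj (UnitAddTorus.mFourier k y) * g y :=
          (Complex.continuous_conj.comp (UnitAddTorus.mFourier k).continuous).stronglyMeasurable.mul hg
        rw [integral_congr_ae h1, hν, integral_map hT.aemeasurable h2.aestronglyMeasurable]
        refine integral_congr_ae ?_
        filter_upwards [hgT] with x hx
        rw [mFourier_toTorus, ← hx, Function.comp_apply]
    rw [(Submodule.topologicalClosure_eq_top_iff).mp (dense_span_mFourier ν)] at hmem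
    simpa using hmem
  have hg0 : g =ᵐ[ν] 0 := by
    refine hgm.coeFn_toLp.symm.trans ?_
    rw [hzero]
    exact Lp.coeFn_zero _ _ _
  have hg1 := ae_of_ae_map hT.aemeasurable hg0
  rw [Lp.eq_zero_iff_ae_eq_zero]
  filter_upwards [hgT, hg1] with x h1 h2
  rw [← h1]
  exact h2

/-- The Fourier basis of `L2 b`. -/
def fourierBasis : HilbertBasis (Fin d → ℤ) ℂ (L2 b) :=
  HilbertBasis.mkOfOrthogonalEqBot (orthonormal_planeWaveL2 b) (by
    rw [Submodule.eq_bot_iff]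
    intro f hf
    refine eq_zero_of_forall_inner_planeWaveL2 b fun k => ?_
    exact (Submodule.mem_orthogonal _ _).mp hf _ (Submodule.subset_span ⟨k, rfl⟩))

theorem fourierBasis_apply (k : Fin d → ℤ) : fourierBasis b k = planeWaveL2 b k := by
  rw [fourierBasis, HilbertBasis.coe_mkOfOrthogonalEqBot]

theorem hasWeakLaplacian_of_contDiff {u : Space d → ℂ} (hu : ContDiff ℝ 2 u)
    (hup : IsPeriodic b u) : HasWeakLaplacian b u (Δ u) := fun _ hφ hφp =>
  integral_mul_laplacian hu (contDiff_infty.mp hφ 2) hup hφp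

variable {b} in
theorem HasWeakLaplacian.congr {u u' g g' : Space d → ℂ} (h : HasWeakLaplacian b u g)
    (hu : u =ᵐ[volume.restrict (cell b)] u') (hg : g =ᵐ[volume.restrict (cell b)] g') :
    HasWeakLaplacian b u' g' := by
  intro φ hφ hφp
  have h1 : ∫ x in cell b, u x * Δ φ x = ∫ x in cell b, u' x * Δ φ x :=
    integral_congr_ae (hu.mono fun x hx => by simp only [hx])
  have h2 : ∫ x in cell b, g x * φ x = ∫ x in cell b, g' x * φ x :=
    integral_congr_ae (hg.mono fun x hx => by simp only [hx])
  rw [← h1, ← h2]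
  exact h φ hφ hφp

theorem laplacian_conj_planeWave (k : Fin d → ℤ) (x : Space d) :
    Δ (fun y => conj (planeWave b k y)) x = -(waveNumberSq b k : ℂ) * conj (planeWave b k x) := by
  rw [funext (conj_planeWave b k), conj_planeWave, laplacian_planeWave]
  congr 3
  have : phase b (-k) = -phase b k := by
    have := phase_sub b 0 k
    rw [zero_sub] at this
    rw [this]
    ext x
    simp [phase_apply]
  simp [waveNumberSq, this]

theorem contDiff_conj {n : WithTop ℕ∞} {f : Space d → ℂ} (hf : ContDiff ℝ n f) :
    ContDiff ℝ n fun x => conj (f x) :=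
  (Complex.conjCLE.contDiff.of_le le_top).comp hf

/-- The weak Laplacian is diagonal in the Fourier basis. -/
theorem hasWeakLaplacian_iff (u g : L2 b) :
    HasWeakLaplacian b u g ↔ IsMultiplied (fourierBasis b) (fun k => -waveNumberSq b k) u g := by
  constructor
  · intro h k
    rw [fourierBasis_apply, inner_planeWaveL2, inner_planeWaveL2]
    -- Testing against a conjugate plane wave isolates one Fourier coefficient.
    have h1 := h _ (contDiff_conj (contDiff_planeWave b k))
      (fun j x => by rw [isPeriodic_planeWave b k j x])
    simp_rw [laplacian_conj_planeWave] at h1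
    have h2 : ∫ x in cell b, u x * (-(waveNumberSq b k : ℂ) * conj (planeWave b k x)) =
        -(waveNumberSq b k : ℂ) * ∫ x in cell b, conj (planeWave b k x) * u x := by
      rw [← integral_const_mul]
      exact integral_congr_ae (Eventually.of_forall fun x => by ring)
    rw [h2] at h1
    simp_rw [mul_comm (conj (planeWave b k _)) (g _)]
    rw [← h1]
    push_cast
    ring
  · intro h φ hφ hφp
    have hφ2 : ContDiff ℝ 2 φ := contDiff_infty.mp hφ 2
    have hc1 : Continuous fun x => conj (φ x) := Complex.continuous_conj.comp hφ2.continuous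
    have hc2 : Continuous fun x => conj (Δ φ x) :=
      Complex.continuous_conj.comp (continuous_laplacian hφ2)
    -- Green's identity gives the multiplier relation for the smooth test function; Parseval then
    -- moves the Laplacian from `φ` to `u`.
    have hm : IsMultiplied (fourierBasis b) (fun k => -waveNumberSq b k) (toL2 b hc1)
        (toL2 b hc2) := by
      intro k
      rw [fourierBasis_apply, inner_planeWaveL2_toL2, inner_planeWaveL2_toL2]
      have h1 := integral_mul_laplacian (b := b) (contDiff_planeWave b k) hφ2
        (isPeriodic_planeWave b k) hφp
      simp_rw [laplacian_planeWave, mul_assoc] at h1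
      rw [integral_const_mul] at h1
      simp_rw [← map_mul]
      rw [integral_conj, integral_conj, h1, map_mul, map_neg, Complex.conj_ofReal]
      push_cast
      ring
    have h2 := hm.inner_comm h
    rw [inner_toL2, inner_toL2] at h2
    simp_rw [Complex.conj_conj] at h2
    simpa only [mul_comm] using h2

end FourierCompleteness

/-! ### `H`, `G` and `Θ` as bounded perturbations of the diagonal Laplacian. -/

section Operators

variable {d : ℕ} (b : Module.Basis (Fin d) ℝ (Space d))

/-- Multiplication by a continuous real function, as a bounded operator in `L2 b`. -/
def mulOp (a : Space d → ℝ) (ha : Continuous a) : L2 b →L[ℂ] L2 b :=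
  (ContinuousLinearMap.mul ℂ ℂ).holderL (volume.restrict (cell b)) ⊤ 2 2
    ((memLp_cell b (Complex.continuous_ofReal.comp ha) ⊤).toLp _)

theorem coeFn_mulOp {a : Space d → ℝ} (ha : Continuous a) (u : L2 b) :
    mulOp b a ha u =ᵐ[volume.restrict (cell b)] fun x => (a x : ℂ) * u x := by
  filter_upwards [(ContinuousLinearMap.mul ℂ ℂ).coeFn_holder (r := 2)
    ((memLp_cell b (Complex.continuous_ofReal.comp ha) ⊤).toLp _) u,
    (memLp_cell b (Complex.continuous_ofReal.comp ha) ⊤).coeFn_toLp] with x h1 h2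
  rw [h2] at h1
  exact h1

theorem mulOp_isSymmetric {a : Space d → ℝ} (ha : Continuous a) : (mulOp b a ha).IsSymmetric := by
  intro u v
  change ⟪mulOp b a ha u, v⟫_ℂ = ⟪u, mulOp b a ha v⟫_ℂ
  rw [L2.inner_def, L2.inner_def]
  refine integral_congr_ae ?_
  filter_upwards [coeFn_mulOp b ha u, coeFn_mulOp b ha v] with x h1 h2
  rw [h1, h2, RCLike.inner_apply, RCLike.inner_apply, map_mul, Complex.conj_ofReal]
  ring

theorem opH_iff {V : Space d → ℝ} (hV : Continuous V) (E : ℝ) (u w : L2 b) :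
    opH b V E u w ↔ PerturbedGraph (fourierBasis b) (waveNumberSq b)
      (mulOp b (fun x => V x - E) (hV.sub continuous_const)) u w := by
  refine exists_congr fun g => and_congr (hasWeakLaplacian_iff b u g) ?_
  rw [Lp.ext_iff]
  refine eventually_congr ?_
  filter_upwards [Lp.coeFn_add ((-(1 / 2) : ℂ) • g)
    (mulOp b (fun x => V x - E) (hV.sub continuous_const) u),
    Lp.coeFn_smul (-(1 / 2) : ℂ) g,
    coeFn_mulOp b (a := fun x => V x - E) (hV.sub continuous_const) u] with x h1 h2 h3
  rw [h1, Pi.add_apply, h2, h3, Pi.smul_apply, smul_eq_mul]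
  rw [Complex.ofReal_sub]

/-- The convention `0⁻¹ = 0` makes the multiplier at `k = 0` vanish, which is exactly the
annihilation of constants. Boundedness follows from convergence to zero along the cofinite filter.
-/
theorem exists_inverseLaplacian : ∃ N : L2 b →L[ℂ] L2 b,
    ∀ u, IsMultiplied (fourierBasis b) (fun k => -(waveNumberSq b k)⁻¹) u (N u) := by
  have h : Tendsto (fun k => |-(waveNumberSq b k)⁻¹|) cofinite (𝓝 0) := by
    simpa using ((tendsto_inv_atTop_zero.comp (tendsto_waveNumberSq b)).neg).abs
  obtain ⟨C, hC⟩ := h.bddAbove_range_of_cofinite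
  obtain ⟨N, hN, -⟩ := exists_diagonal (fourierBasis b) (κ := fun k => -(waveNumberSq b k)⁻¹)
    ((abs_nonneg _).trans (hC ⟨0, rfl⟩)) (fun k => hC ⟨k, rfl⟩)
  exact ⟨N, hN⟩

/-- The inverse Laplacian on the periodic domain, annihilating the constants. -/
def inverseLaplacian : L2 b →L[ℂ] L2 b := (exists_inverseLaplacian b).choose

theorem isMultiplied_inverseLaplacian (u : L2 b) :
    IsMultiplied (fourierBasis b) (fun k => -(waveNumberSq b k)⁻¹) u (inverseLaplacian b u) :=
  (exists_inverseLaplacian b).choose_spec u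

theorem inner_fourierBasis_zero (u : L2 b) :
    ⟪fourierBasis b 0, u⟫_ℂ = waveNorm b * ∫ x in cell b, u x := by
  rw [fourierBasis_apply, inner_planeWaveL2]
  simp [planeWave_zero]

theorem inner_fourierBasis_sub_average (f : L2 b) (k : Fin d → ℤ) :
    ⟪fourierBasis b k, f - toL2 b (continuous_const (y := ⨍ y in cell b, f y))⟫_ℂ =
      if k = 0 then 0 else ⟪fourierBasis b k, f⟫_ℂ := by
  rw [inner_sub_right]
  split_ifs with h
  · subst h
    rw [inner_fourierBasis_zero, inner_fourierBasis_zero, integral_congr_ae (coeFn_toL2 b _),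
      ← mul_sub, integral_const, setAverage_eq, measureReal_restrict_apply_univ,
      smul_inv_smul₀ (volume_cell_pos b).ne', sub_self, mul_zero]
  · rw [fourierBasis_apply, inner_planeWaveL2_toL2, integral_mul_const]
    simp_rw [conj_planeWave]
    rw [integral_planeWave b (neg_ne_zero.mpr h), zero_mul, mul_zero, sub_zero]

theorem isInverseLaplacian_iff {f : Space d → ℂ} {F : L2 b}
    (hF : F =ᵐ[volume.restrict (cell b)] f) (v : L2 b) :
    IsInverseLaplacian b f v ↔ v = inverseLaplacian b F := by
  have havg : ⨍ y in cell b, F y = ⨍ y in cell b, f y := average_congr hF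
  set G : L2 b := F - toL2 b (continuous_const (y := ⨍ y in cell b, F y)) with hG
  have hGf : G =ᵐ[volume.restrict (cell b)] fun x => f x - ⨍ y in cell b, f y := by
    filter_upwards [hF, Lp.coeFn_sub F (toL2 b (continuous_const (y := ⨍ y in cell b, F y))),
      coeFn_toL2 b (continuous_const (y := ⨍ y in cell b, F y))] with x h1 h2 h3
    rw [hG, h2, Pi.sub_apply, h1, h3, havg]
  have hw : HasWeakLaplacian b v (fun x => f x - ⨍ y in cell b, f y) ↔
      HasWeakLaplacian b v G :=
    ⟨fun h => h.congr EventuallyEq.rfl hGf.symm, fun h => h.congr EventuallyEq.rfl hGf⟩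
  have hz : (∫ x in cell b, v x) = 0 ↔ ⟪fourierBasis b 0, v⟫_ℂ = 0 := by
    rw [inner_fourierBasis_zero, mul_eq_zero,
      or_iff_right (by exact_mod_cast (waveNorm_pos b).ne')]
  have hN := isMultiplied_inverseLaplacian b F
  rw [IsInverseLaplacian, hw, hz, hasWeakLaplacian_iff]
  have hne : ∀ k, k ≠ 0 → (waveNumberSq b k : ℂ) ≠ 0 := fun k hk => by
    exact_mod_cast (waveNumberSq_pos b hk).ne'
  constructor
  · rintro ⟨h0, h⟩
    refine eq_of_forall_inner_eq (fourierBasis b) fun k => ?_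
    rw [hN k]
    by_cases hk : k = 0
    · subst hk
      simp [h0, waveNumberSq_zero]
    · have h1 := h k
      rw [hG, inner_fourierBasis_sub_average, if_neg hk] at h1
      rw [h1]
      have := hne k hk
      push_cast
      field_simp
  · rintro rfl
    refine ⟨by rw [hN 0]; simp [waveNumberSq_zero], fun k => ?_⟩
    rw [hG, inner_fourierBasis_sub_average, hN k]
    split_ifs with hk
    · subst hk
      simp [waveNumberSq_zero]
    · have := hne k hk
      push_cast
      field_simp

/-- The gravitational interaction `2 Ψ ∇⁻² Ψ` as a bounded operator. -/
def interactionOp {Ψ : Space d → ℝ} (hΨ : Continuous Ψ) : L2 b →L[ℂ] L2 b :=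
  (2 : ℂ) • (mulOp b Ψ hΨ ∘L inverseLaplacian b ∘L mulOp b Ψ hΨ)

theorem interactionOp_isSymmetric {Ψ : Space d → ℝ} (hΨ : Continuous Ψ) :
    (interactionOp b hΨ).IsSymmetric := by
  have hM : ∀ u v, ⟪mulOp b Ψ hΨ u, v⟫_ℂ = ⟪u, mulOp b Ψ hΨ v⟫_ℂ := mulOp_isSymmetric b hΨ
  intro u v
  change ⟪(2 : ℂ) • mulOp b Ψ hΨ (inverseLaplacian b (mulOp b Ψ hΨ u)), v⟫_ℂ =
    ⟪u, (2 : ℂ) • mulOp b Ψ hΨ (inverseLaplacian b (mulOp b Ψ hΨ v))⟫_ℂ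
  rw [inner_smul_left, inner_smul_right, hM, ← hM u,
    (isMultiplied_inverseLaplacian b _).inner_comm (isMultiplied_inverseLaplacian b _),
    Complex.conj_ofNat]

theorem opG_iff {Ψ : Space d → ℝ} (hΨ : Continuous Ψ) (u w : L2 b) :
    opG b Ψ u w ↔ w = interactionOp b hΨ u := by
  have h1 : ∀ v w : L2 b, (∀ᵐ x ∂(volume.restrict (cell b)), w x = 2 * (Ψ x : ℂ) * v x) ↔
      w = (2 : ℂ) • mulOp b Ψ hΨ v := by
    intro v w
    rw [Lp.ext_iff]
    refine eventually_congr ?_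
    filter_upwards [coeFn_mulOp b hΨ v, Lp.coeFn_smul (2 : ℂ) (mulOp b Ψ hΨ v)] with x h1 h2
    rw [h2, Pi.smul_apply, h1, smul_eq_mul, mul_assoc]
  simp only [opG, h1, isInverseLaplacian_iff b (coeFn_mulOp b hΨ u), exists_eq_left]
  rfl

theorem thetaPotential_isSymmetric {Ψ V : Space d → ℝ} (hΨ : Continuous Ψ) (hV : Continuous V)
    (E : ℝ) : (mulOp b (fun x => V x - E) (hV.sub continuous_const) +
      interactionOp b hΨ).IsSymmetric :=
  (mulOp_isSymmetric b _).add (interactionOp_isSymmetric b hΨ)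

theorem opTheta_iff {Ψ V : Space d → ℝ} (hΨ : Continuous Ψ) (hV : Continuous V) (E : ℝ)
    (u w : L2 b) :
    opTheta b Ψ V E u w ↔ PerturbedGraph (fourierBasis b) (waveNumberSq b)
      (mulOp b (fun x => V x - E) (hV.sub continuous_const) + interactionOp b hΨ) u w := by
  simp only [opTheta, opG_iff b hΨ, opH_iff b hV]
  constructor
  · rintro ⟨h, k, ⟨g, hg, rfl⟩, rfl, rfl⟩
    exact ⟨g, hg, by rw [add_apply, add_assoc]⟩
  · rintro ⟨g, hg, rfl⟩
    exact ⟨_, _, ⟨g, hg, rfl⟩, rfl, by rw [add_apply, add_assoc]⟩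

end Operators

/-! ### Trigonometric polynomials as smooth approximants. -/

section FourierSums

variable {d : ℕ} (b : Module.Basis (Fin d) ℝ (Space d)) (s : Finset (Fin d → ℤ))
  (a : (Fin d → ℤ) → ℂ)

/-- The trigonometric polynomial with given coefficients in the Fourier basis. -/
def fourierSum (x : Space d) : ℂ := ∑ k ∈ s, a k * (waveNorm b * planeWave b k x)

theorem contDiff_fourierSum {n : WithTop ℕ∞} : ContDiff ℝ n (fourierSum b s a) :=
  ContDiff.sum fun k _ => contDiff_const.mul (contDiff_const.mul (contDiff_planeWave b k))

theorem isPeriodic_fourierSum : IsPeriodic b (fourierSum b s a) := fun j x => by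
  simp only [fourierSum, isPeriodic_planeWave b _ j x]

theorem coeFn_fourierSum : (∑ k ∈ s, a k • fourierBasis b k : L2 b)
    =ᵐ[volume.restrict (cell b)] fourierSum b s a := by
  classical
  induction s using Finset.induction_on with
  | empty =>
    filter_upwards [Lp.coeFn_zero ℂ 2 (volume.restrict (cell b))] with x hx
    simp only [Finset.sum_empty, hx, fourierSum, Pi.zero_apply]
  | insert k s hk ih =>
    rw [Finset.sum_insert hk, fourierBasis_apply, planeWaveL2, smul_smul]
    filter_upwards [ih, Lp.coeFn_add ((a k * (waveNorm b : ℂ)) •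
        toL2 b (contDiff_planeWave b k (n := 0)).continuous)
        (∑ k ∈ s, a k • fourierBasis b k : L2 b),
      Lp.coeFn_smul (a k * (waveNorm b : ℂ))
        (toL2 b (contDiff_planeWave b k (n := 0)).continuous),
      coeFn_toL2 b (contDiff_planeWave b k (n := 0)).continuous] with x h1 h2 h3 h4
    rw [h2, Pi.add_apply, h1, h3, Pi.smul_apply, h4, fourierSum, fourierSum,
      Finset.sum_insert hk, smul_eq_mul, mul_assoc]

end FourierSums

/-! ### Consequences of the equilibrium equations and of the instability. -/

section Equilibrium

variable {d : ℕ} {b : Module.Basis (Fin d) ℝ (Space d)} {Ψ V : Space d → ℝ} {E Λ : ℝ}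

theorem IsEquilibrium.opH_wave (h : IsEquilibrium b Ψ V E Λ) {ψ : L2 b}
    (hψ : ∀ᵐ x ∂(volume.restrict (cell b)), ψ x = (Ψ x : ℂ)) : opH b V E ψ 0 := by
  have hc : ContDiff ℝ 2 fun x => (Ψ x : ℂ) :=
    (Complex.ofRealCLM.contDiff.of_le le_top).comp h.contDiff_wave
  have hΔ : ∀ x, Δ (fun x => (Ψ x : ℂ)) x = ((Δ Ψ x : ℝ) : ℂ) := fun x =>
    h.contDiff_wave.contDiffAt.laplacian_CLM_comp_left (l := Complex.ofRealCLM)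
  have hw := hasWeakLaplacian_of_contDiff b hc
    (fun j x => by rw [h.periodic_wave j x])
  refine ⟨toL2 b (continuous_laplacian hc),
    hw.congr (hψ.mono fun x hx => hx.symm) (coeFn_toL2 b _).symm, ?_⟩
  filter_upwards [hψ, coeFn_toL2 b (continuous_laplacian hc),
    Lp.coeFn_zero ℂ 2 (volume.restrict (cell b))] with x h1 h2 h3
  have h4 := h.schrodinger x
  rw [h1, h2, h3, hΔ, Pi.zero_apply]
  have h5 : (0 : ℝ) = -(1 / 2) * Δ Ψ x + (V x - E) * Ψ x := by linarith
  have h6 := congrArg ((↑) : ℝ → ℂ) h5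
  push_cast at h6
  exact h6

/-- The Schrödinger equation divided by `Ψ` gives `V - E = ΔΨ / (2Ψ)`, so the form of `H` is half
the Picone integral. -/
theorem IsEquilibrium.inner_nonneg_of_contDiff (h : IsEquilibrium b Ψ V E Λ) (h0 : ∀ x, Ψ x ≠ 0)
    {φ : Space d → ℂ} (hφ : ContDiff ℝ 2 φ) (hφp : IsPeriodic b φ) {u g w : L2 b}
    (hu : u =ᵐ[volume.restrict (cell b)] φ) (hg : g =ᵐ[volume.restrict (cell b)] Δ φ)
    (hw : ∀ᵐ x ∂(volume.restrict (cell b)),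
      w x = -(1 / 2) * g x + ((V x : ℂ) - (E : ℂ)) * u x) :
    0 ≤ (⟪u, w⟫_ℂ).re := by
  have hval : ⟪u, w⟫_ℂ = ((1 / 2 : ℝ) : ℂ) *
      ∫ x in cell b, conj (φ x) * (-Δ φ x + ((Δ Ψ x / Ψ x : ℝ) : ℂ) * φ x) := by
    rw [L2.inner_def, ← integral_const_mul]
    refine integral_congr_ae ?_
    filter_upwards [hu, hg, hw] with x h1 h2 h3
    have h6 : V x - E = 1 / 2 * (Δ Ψ x / Ψ x) := by
      have h7 := h.schrodinger x
      have h8 := h0 x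
      field_simp
      linarith
    have h9 : (V x : ℂ) - (E : ℂ) = 1 / 2 * ((Δ Ψ x / Ψ x : ℝ) : ℂ) := by
      rw [← Complex.ofReal_sub, h6]
      push_cast
      rfl
    rw [RCLike.inner_apply, h3, h1, h2, h9]
    push_cast
    ring
  rw [hval, Complex.re_ofReal_mul]
  exact mul_nonneg (by norm_num)
    (integral_picone_nonneg h.contDiff_wave hφ h.periodic_wave hφp h0)

/-- If the wave function has no zeros, then `H` is nonnegative. -/
theorem IsEquilibrium.inner_nonneg_of_forall_ne_zero (h : IsEquilibrium b Ψ V E Λ)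
    (h0 : ∀ x, Ψ x ≠ 0) {u w : L2 b} (hu : opH b V E u w) : 0 ≤ (⟪u, w⟫_ℂ).re := by
  have hV := h.contDiff_potential.continuous
  obtain ⟨g, hg, rfl⟩ := (opH_iff b hV E u w).mp hu
  -- Picone's inequality needs `C²` functions, so `u` is replaced by its Fourier partial sums. The
  -- Laplacian being diagonal, the partial sums of `g` are their Laplacians, and the form converges.
  have hlim : ∀ v, Tendsto (fun s : Finset (Fin d → ℤ) =>
      ∑ k ∈ s, ⟪fourierBasis b k, v⟫_ℂ • fourierBasis b k) atTop (𝓝 v) := fun v => by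
    have := (fourierBasis b).hasSum_repr v
    simp_rw [(fourierBasis b).repr_apply_apply] at this
    exact this
  have hlim2 := (Complex.continuous_re.tendsto _).comp ((hlim u).inner
    (((hlim g).const_smul (-(1 / 2) : ℂ)).add
      (((mulOp b (fun x => V x - E) (hV.sub continuous_const)).continuous.tendsto u).comp
        (hlim u))))
  refine ge_of_tendsto' hlim2 fun s => ?_
  have hopH := (opH_iff b hV E (∑ k ∈ s, ⟪fourierBasis b k, u⟫_ℂ • fourierBasis b k) _).mpr
    ⟨∑ k ∈ s, ⟪fourierBasis b k, g⟫_ℂ • fourierBasis b k, ?_, rfl⟩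
  · obtain ⟨g', hg', hw⟩ := hopH
    refine h.inner_nonneg_of_contDiff h0 (contDiff_fourierSum b s _) (isPeriodic_fourierSum b s _)
      (coeFn_fourierSum b s _) ?_ hw
    have hsum := hasWeakLaplacian_of_contDiff b (contDiff_fourierSum b s
      fun k => ⟪fourierBasis b k, u⟫_ℂ) (isPeriodic_fourierSum b s _)
    have hc := continuous_laplacian (contDiff_fourierSum b s fun k => ⟪fourierBasis b k, u⟫_ℂ)
    have heq : g' = toL2 b hc := by
      refine IsMultiplied.unique ((hasWeakLaplacian_iff b _ _).mp hg')
        ((hasWeakLaplacian_iff b _ _).mp ?_)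
      exact hsum.congr (coeFn_fourierSum b s _).symm (coeFn_toL2 b hc).symm
    rw [heq]
    exact coeFn_toL2 b hc
  · intro k
    classical
    simp only [inner_sum, inner_smul_right, orthonormal_iff_ite.mp (fourierBasis b).orthonormal,
      mul_ite, mul_one, mul_zero, Finset.sum_ite_eq]
    split_ifs
    · exact hg k
    · rfl

/-- Since `HΨ = 0`, the only eigenvalue `Ψ` can have is `0`, which lies above `e`. -/
theorem IsEquilibrium.not_isGroundState (h : IsEquilibrium b Ψ V E Λ) {e : ℝ} (he : e < 0)
    (hE : IsEigenvalue (opH b V E) (e : ℂ)) : ¬ IsGroundState (opH b V E) Ψ := by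
  have hV := h.contDiff_potential.continuous
  rintro ⟨ψ, e', hψ, ⟨hψ0, hψe⟩, hmin⟩
  have h3 := ((opH_iff b hV E _ _).mp hψe).unique ((opH_iff b hV E _ _).mp (h.opH_wave hψ))
  have h4 : e' = 0 := by
    have := (smul_eq_zero.mp h3).resolve_right hψ0
    exact_mod_cast this
  linarith [hmin e hE]

theorem IsEquilibrium.exists_eq_zero (h : IsEquilibrium b Ψ V E Λ) {e : ℝ} (he : e < 0)
    (hE : IsEigenvalue (opH b V E) (e : ℂ)) : ∃ x, Ψ x = 0 := by
  by_contra! h0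
  obtain ⟨f, hf, hfe⟩ := hE
  have h3 := h.inner_nonneg_of_forall_ne_zero h0 hfe
  rw [inner_smul_right, Complex.re_ofReal_mul] at h3
  have h4 : (⟪f, f⟫_ℂ).re = ‖f‖ ^ 2 := inner_self_eq_norm_sq (𝕜 := ℂ) f
  have h5 : 0 < ‖f‖ := norm_pos_iff.mpr hf
  rw [h4] at h3
  exact absurd h3 (not_le.mpr (mul_neg_of_neg_of_pos he (by positivity)))

/-- The quadratic forms of `H` and `Θ` vanish at a propagating instability. -/
theorem exists_inner_eq_zero_of_eigenvalue (hΨ : Continuous Ψ) (hV : Continuous V) {c : ℂ}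
    (hc : c.im ≠ 0) (h : IsEigenvalue (opThetaH b Ψ V E) c) :
    ∃ η R w : L2 b, opH b V E η R ∧ opTheta b Ψ V E R w ∧ R ≠ 0 ∧ w ≠ 0 ∧
      ⟪η, R⟫_ℂ = 0 ∧ ⟪R, w⟫_ℂ = 0 := by
  obtain ⟨η, hη, R, hR, hΘ⟩ := h
  have hR' := (opH_iff b hV E η R).mp hR
  have hΘ' := (opTheta_iff b hΨ hV E R _).mp hΘ
  have hc0 : c ≠ 0 := fun h => hc (by rw [h, Complex.zero_im])
  have hcη : c • η ≠ 0 := smul_ne_zero hc0 hη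
  have h1 : ⟪R, η⟫_ℂ = ⟪η, R⟫_ℂ := hR'.inner_comm (mulOp_isSymmetric b _) hR'
  have h2 : ⟪c • η, R⟫_ℂ = ⟪R, c • η⟫_ℂ :=
    hΘ'.inner_comm (thetaPotential_isSymmetric b hΨ hV E) hΘ'
  -- If this were nonzero, cancelling it in `h2` would give `conj c = c`.
  have hRη : ⟪η, R⟫_ℂ = 0 := by
    rw [inner_smul_left, inner_smul_right, h1] at h2
    by_contra hne
    exact hc (Complex.conj_eq_iff_im.mp (mul_right_cancel₀ hne h2))
  refine ⟨η, R, c • η, hR, hΘ, ?_, hcη, hRη, ?_⟩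
  · rintro rfl
    exact hcη hΘ'.zero_left
  · rw [inner_smul_right, h1, hRη, mul_zero]

theorem exists_eigenvalue_opH (hV : Continuous V) {u w : L2 b} (hu : opH b V E u w)
    (huw : ⟪u, w⟫_ℂ = 0) (hw : w ≠ 0) {s : ℝ} (hs : s ≠ 0) :
    ∃ e : ℝ, 0 < s * e ∧ IsEigenvalue (opH b V E) (e : ℂ) := by
  obtain ⟨e, he, v, hv, hve⟩ := exists_eigenvalue_of_inner_eq_zero (waveNumberSq_nonneg b)
    (tendsto_waveNumberSq b) (mulOp_isSymmetric b _) ((opH_iff b hV E u w).mp hu) huw hw hs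
  exact ⟨e, he, v, hv, (opH_iff b hV E _ _).mpr hve⟩

theorem exists_eigenvalue_opTheta (hΨ : Continuous Ψ) (hV : Continuous V) {u w : L2 b}
    (hu : opTheta b Ψ V E u w) (huw : ⟪u, w⟫_ℂ = 0) (hw : w ≠ 0) {s : ℝ} (hs : s ≠ 0) :
    ∃ e : ℝ, 0 < s * e ∧ IsEigenvalue (opTheta b Ψ V E) (e : ℂ) := by
  obtain ⟨e, he, v, hv, hve⟩ := exists_eigenvalue_of_inner_eq_zero (waveNumberSq_nonneg b)
    (tendsto_waveNumberSq b) (thetaPotential_isSymmetric b hΨ hV E)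
    ((opTheta_iff b hΨ hV E u w).mp hu) huw hw hs
  exact ⟨e, he, v, hv, (opTheta_iff b hΨ hV E _ _).mpr hve⟩

end Equilibrium

end SchrodingerPoisson

end

theorem mainTheorem2 {d : ℕ}
    (b : Module.Basis (Fin d) ℝ (SchrodingerPoisson.Space d))
    (Ψ V : SchrodingerPoisson.Space d → ℝ) (E Λ : ℝ)
    (heq : SchrodingerPoisson.IsEquilibrium b Ψ V E Λ)
    (ω : ℂ)
    (hω : SchrodingerPoisson.IsEigenvalue (SchrodingerPoisson.opThetaH b Ψ V E) (ω ^ 2))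
    (hnonreal : (ω ^ 2).im ≠ 0) :
    ((∃ e : ℝ, 0 < e ∧
        SchrodingerPoisson.IsEigenvalue (SchrodingerPoisson.opH b V E) (e : ℂ)) ∧
      (∃ e : ℝ, e < 0 ∧
        SchrodingerPoisson.IsEigenvalue (SchrodingerPoisson.opH b V E) (e : ℂ))) ∧
    ((∃ e : ℝ, 0 < e ∧
        SchrodingerPoisson.IsEigenvalue (SchrodingerPoisson.opTheta b Ψ V E) (e : ℂ)) ∧
      (∃ e : ℝ, e < 0 ∧
        SchrodingerPoisson.IsEigenvalue (SchrodingerPoisson.opTheta b Ψ V E) (e : ℂ))) ∧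
    ¬ SchrodingerPoisson.IsGroundState (SchrodingerPoisson.opH b V E) Ψ ∧
    ∃ x : SchrodingerPoisson.Space d, Ψ x = 0 := by
  have hV := heq.contDiff_potential.continuous
  have hΨ := heq.contDiff_wave.continuous
  obtain ⟨η, R, w, hR, hΘ, hR0, hw0, hηR, hRw⟩ :=
    SchrodingerPoisson.exists_inner_eq_zero_of_eigenvalue hΨ hV hnonreal hω
  have hH := fun (s : ℝ) (hs : s ≠ 0) =>
    SchrodingerPoisson.exists_eigenvalue_opH hV hR hηR hR0 hs
  have hT := fun (s : ℝ) (hs : s ≠ 0) =>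
    SchrodingerPoisson.exists_eigenvalue_opTheta hΨ hV hΘ hRw hw0 hs
  -- The choices `s = 1` and `s = -1` select the positive and the negative eigenvalue.
  obtain ⟨e₁, he₁, hE₁⟩ := hH 1 one_ne_zero
  obtain ⟨e₂, he₂, hE₂⟩ := hH (-1) (by norm_num)
  obtain ⟨e₃, he₃, hE₃⟩ := hT 1 one_ne_zero
  obtain ⟨e₄, he₄, hE₄⟩ := hT (-1) (by norm_num)
  have he₂' : e₂ < 0 := by linarith
  exact ⟨⟨⟨e₁, by linarith, hE₁⟩, e₂, he₂', hE₂⟩,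
    ⟨⟨e₃, by linarith, hE₃⟩, e₄, by linarith, hE₄⟩,
    heq.not_isGroundState he₂' hE₂, heq.exists_eq_zero he₂' hE₂⟩
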